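/- Let $p$ be a prime and let $(A,\mathfrak m)$ be a Noetherian Cohen--Macaulay local ring of characteristic $p$ and dimension $d\ge 1$. Let $I$ be an $\mathfrak m$-primary ideal of $A$, and let $J$ be a minimal reduction of $I$, that is, an ideal that is minimal under inclusion among the ideals $K\subseteq I$ with $I^{n+1}=KI^n$ for some $n\ge 0$. Suppose that the residue field $A/\mathfrak m$ is infinite or, more generally, that $J$ is generated by $d$ elements, and suppose that $I^2\subseteq J$. For $q=p^e$ let $I^{[q]}$ be the ideal generated by all $a^q$ with $a\in I$. Then the limits $$\mathrm e(I)=\lim_{n\to\infty}\frac{d!}{n^d}\,\ell_A(A/I^{n+1}),\qquad \mathrm e_{HK}(I)=\lim_{e\to\infty}\frac{\ell_A(A/I^{[p^e]})}{p^{ed}}$$ exist (the multiplicity and the Hilbert--Kunz multiplicity of $I$), and $$\mathrm e_{HK}(I)\ \ge\ \frac{\mathrm e(I)}{2}.$$ -/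

import Mathlib

open Filter Topology

universe u

noncomputable section

/-- A (Noetherian) local ring is Cohen–Macaulay if its maximal ideal contains an `A`-regular
sequence whose length is the Krull dimension of `A`. -/
def IsCohenMacaulayLocal (A : Type u) [CommRing A] [IsLocalRing A] : Prop :=
  ∃ rs : List A, (∀ r ∈ rs, r ∈ IsLocalRing.maximalIdeal A) ∧
    RingTheory.Sequence.IsRegular A rs ∧ ringKrullDim A = (rs.length : WithBot ℕ∞)

/-- `J` is a reduction of `I`: `J ⊆ I` and `I ^ (n + 1) = J I ^ n` for some `n ≥ 0`. -/
def IsReduction {A : Type u} [CommRing A] (J I : Ideal A) : Prop :=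
  J ≤ I ∧ ∃ n : ℕ, I ^ (n + 1) = J * I ^ n

/-- `J` is a minimal reduction of `I`: it is minimal under inclusion among the reductions
of `I`. -/
def IsMinimalReduction {A : Type u} [CommRing A] (J I : Ideal A) : Prop :=
  Minimal (fun K : Ideal A => IsReduction K I) J

/-- The ideal `I^{[q]}` generated by the `q`-th powers of the elements of `I`. -/
def frobeniusPower {A : Type u} [CommRing A] (I : Ideal A) (q : ℕ) : Ideal A :=
  Ideal.span ((fun a : A => a ^ q) '' (I : Set A))

/-- The length of `A / I` as a real number (used only for ideals of finite colength). -/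
def colength {A : Type u} [CommRing A] (I : Ideal A) : ℝ :=
  ((Module.length A (A ⧸ I)).toNat : ℝ)

/-- The sequence `d! ℓ(A / I ^ (n + 1)) / n ^ d`, whose limit is `e(I)` when `dim A = d`. -/
def multiplicitySeq {A : Type u} [CommRing A] (d : ℕ) (I : Ideal A) (n : ℕ) : ℝ :=
  (Nat.factorial d : ℝ) / (n : ℝ) ^ d * colength (I ^ (n + 1))

/-- The sequence `ℓ(A / I^{[q]}) / q ^ d`, `q = p ^ e`, whose limit is `e_HK(I)` when
`dim A = d`. -/
def hilbertKunzSeq {A : Type u} [CommRing A] (p d : ℕ) (I : Ideal A) (e : ℕ) : ℝ :=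
  colength (frobeniusPower I (p ^ e)) / ((p ^ e : ℕ) : ℝ) ^ d

/-- The multiplicity `e(I)` of an ideal in a local ring of dimension `d`. -/
def idealMultiplicity {A : Type u} [CommRing A] (d : ℕ) (I : Ideal A) : ℝ :=
  limUnder atTop (multiplicitySeq d I)

/-- The Hilbert–Kunz multiplicity `e_HK(I)` of an ideal in a local ring of dimension `d` and
characteristic `p`. -/
def hilbertKunzMultiplicity {A : Type u} [CommRing A] (p d : ℕ) (I : Ideal A) : ℝ :=
  limUnder atTop (hilbertKunzSeq p d I)

end

/-!
Let `k` be the residue field, `Â` the completion, and suppose that `J = (x₁, …, x_d)`. As `k` is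
formally smooth over `𝔽_p`, it lifts to a coefficient field of `Â`, and `Â` becomes a finite algebra
over `P = k⟦x₁, …, x_d⟧`. It is free of rank `ℓ(A/J)`, because the parameters `xᵢ` form a regular
sequence and hence `ℓ(A/(x₁^q, …, x_d^q)) = q^d ℓ(A/J)`. In particular `e(I) = e(J) = ℓ(A/J)`.

Let `F` be the fraction field of `P`. The `F`-span of the `p^s`-th powers of the finite-dimensional
algebra `F ⊗ Â` is, for large `s`, a reduced algebra, hence a finite product of fields over which
`F ⊗ Â` is a module. After clearing denominators this yields two structures on `Â`.

* An additive map `ψ`, whose image spans generically, with `ψ (c r) = c^p ψ r` for `c ∈ P` and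
  `ψ (a^q r) = a^(pq) ψ r` for all powers `q ≥ p^s` of `p`. It gives
  `ℓ(A/I^[pq]) ≤ p^d ℓ(A/I^[q]) + O(q^(d-1))`, so that `ℓ(A/I^[q]) / q^d` converges.
* A generically nondegenerate `P`-bilinear form `β` with `β (a^q r, t) = β (r, a^q t)` for all
  powers `q ≥ p^s` of `p`. The product of two generators `a^q`, `b^q` of `I^[q]` lies in
  `(x₁^q, …, x_d^q)`, because `I² ⊆ J`. So `I^[q]` is isotropic for the coefficient of `β` at
  `(x₁ ⋯ x_d)^(q-1)`, and the codimension of an isotropic subspace is at least half the dimension: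
  `q^d ℓ(A/J) ≤ 2 ℓ(A/I^[q]) + O(q^(d-1))`.

If `k` is infinite, a minimal reduction `J` has `d` generators: since `ℓ(A/J^n)` grows only like
`n^d`, more than `d` generators satisfy modulo `𝔪 J^n` a form of degree `n` with a unit coefficient,
and after a general linear change of the generators one of them can be omitted.
-/

/-! ### Algebras spanned by `p`-th powers -/

section FrobeniusSpan

variable {K : Type*} [Field K] (p : ℕ)

variable (K) in
/-- The subalgebra `K[A^{p^s}]` generated by the `p ^ s`-th powers. For finite-dimensional `A` the
decreasing sequence of these subalgebras becomes stationary at a reduced algebra. -/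
def powAdjoin (A : Type*) [CommRing A] [Algebra K A] (s : ℕ) : Subalgebra K A :=
  Algebra.adjoin K (Set.range fun a : A => a ^ p ^ s)

section PowAdjoin

variable {A : Type*} [CommRing A] [Algebra K A]

theorem pow_mem_powAdjoin (s : ℕ) (a : A) : a ^ p ^ s ∈ powAdjoin K p A s :=
  Algebra.subset_adjoin ⟨a, rfl⟩

theorem powAdjoin_toSubmodule (s : ℕ) :
    Subalgebra.toSubmodule (powAdjoin K p A s) =
      Submodule.span K (Set.range fun a : A => a ^ p ^ s) := by
  have hrange : (Set.range fun a : A => a ^ p ^ s) =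
      (MonoidHom.mrange (powMonoidHom (α := A) (p ^ s)) : Set A) := by
    ext; simp
  rw [powAdjoin, Algebra.adjoin_eq_span, hrange, Submonoid.closure_eq]

theorem antitone_powAdjoin : Antitone (powAdjoin K p A) := by
  refine antitone_nat_of_succ_le fun s => Algebra.adjoin_mono ?_
  rintro _ ⟨a, rfl⟩
  exact ⟨a ^ p, by simp only [← pow_mul, pow_succ']⟩

variable (K A) in
theorem exists_powAdjoin_eq_succ [FiniteDimensional K A] :
    ∃ s, powAdjoin K p A s = powAdjoin K p A (s + 1) := by
  obtain ⟨s, hs⟩ := IsArtinian.monotone_stabilizes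
    (⟨fun s => OrderDual.toDual (Subalgebra.toSubmodule (powAdjoin K p A s)),
      fun _ _ h => antitone_powAdjoin p h⟩ : ℕ →o (Submodule K A)ᵒᵈ)
  exact ⟨s, Subalgebra.toSubmodule_injective (hs (s + 1) (Nat.le_succ s))⟩

theorem span_range_pow_powAdjoin_eq_top {s : ℕ}
    (hs : powAdjoin K p A s = powAdjoin K p A (s + 1)) :
    Submodule.span K (Set.range fun b : powAdjoin K p A s => b ^ p) = ⊤ := by
  apply Submodule.map_injective_of_injective (f := (powAdjoin K p A s).val.toLinearMap)
    Subtype.val_injective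
  have hrange : LinearMap.range (powAdjoin K p A s).val.toLinearMap =
      Subalgebra.toSubmodule (powAdjoin K p A s) := by
    ext; simp
  rw [Submodule.map_span, Submodule.map_top, hrange]
  apply le_antisymm
  · rw [Submodule.span_le]
    rintro _ ⟨_, ⟨b, rfl⟩, rfl⟩
    exact (b ^ p).2
  · refine (congrArg Subalgebra.toSubmodule hs).trans_le ?_
    rw [powAdjoin_toSubmodule]
    refine Submodule.span_mono ?_
    rintro _ ⟨a, rfl⟩
    exact ⟨_, ⟨⟨a ^ p ^ s, pow_mem_powAdjoin p s a⟩, rfl⟩, by simp [← pow_mul, pow_succ]⟩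

end PowAdjoin

/-- The `p`-th power map on each factor. The library's `frobenius` on the product is not available
when the index type is empty, as the product then does not have characteristic `p`. -/
def piFrobenius {ι : Type*} (C : ι → Type*) [∀ i, CommRing (C i)] [Fact p.Prime]
    [∀ i, CharP (C i) p] : (∀ i, C i) →+ ∀ i, C i :=
  AddMonoidHom.pi fun i => (frobenius (C i) p : C i →+ C i).comp (Pi.evalAddMonoidHom C i)

variable [Fact p.Prime]

section PiFrobenius

variable {ι : Type*} (C : ι → Type*) [∀ i, CommRing (C i)] [∀ i, CharP (C i) p]

@[simp]
theorem piFrobenius_apply (f : ∀ i, C i) (i : ι) : piFrobenius p C f i = f i ^ p := rfl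

theorem piFrobenius_single [DecidableEq ι] (i : ι) (c : C i) :
    piFrobenius p C (Pi.single i c) = Pi.single i (c ^ p) := by
  ext j
  rw [piFrobenius_apply]
  rcases eq_or_ne j i with rfl | hj
  · rw [Pi.single_eq_same, Pi.single_eq_same]
  · rw [Pi.single_eq_of_ne hj, Pi.single_eq_of_ne hj, zero_pow (Fact.out : p.Prime).ne_zero]

variable {B : Type*} [CommRing B] [∀ i, Algebra B (C i)]

theorem piFrobenius_smul (b : B) (f : ∀ i, C i) :
    piFrobenius p C (b • f) = b ^ p • piFrobenius p C f := by
  ext i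
  simp only [piFrobenius_apply, Pi.smul_apply, smul_pow]

theorem span_range_piFrobenius_eq_top [Finite ι] [Algebra K B] [∀ i, Algebra K (C i)]
    [∀ i, IsScalarTower K B (C i)] (hC : ∀ i, Function.Surjective (algebraMap B (C i)))
    (h : Submodule.span K (Set.range fun b : B => b ^ p) = ⊤) :
    Submodule.span K (Set.range (piFrobenius p C)) = ⊤ := by
  classical
  cases nonempty_fintype ι
  rw [eq_top_iff]
  rintro f -
  rw [← Finset.univ_sum_single f]
  refine Submodule.sum_mem _ fun i _ => ?_
  obtain ⟨b, hb⟩ := hC i (f i)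
  let φ : B →ₗ[K] ∀ j, C j :=
    LinearMap.single K C i ∘ₗ (IsScalarTower.toAlgHom K B (C i)).toLinearMap
  have hφ : LinearMap.range φ ≤ Submodule.span K (Set.range (piFrobenius p C)) := by
    rw [← Submodule.map_top, ← h, Submodule.map_span, Submodule.span_le]
    rintro _ ⟨_, ⟨c, rfl⟩, rfl⟩
    exact Submodule.subset_span ⟨Pi.single i (algebraMap B (C i) c), by
      simp [φ, piFrobenius_single]⟩
  rw [← hb]
  exact hφ ⟨b, by simp [φ]⟩

end PiFrobenius

theorem isReduced_of_span_range_pow_eq_top {B : Type*} [CommRing B] [Algebra K B]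
    [FiniteDimensional K B] [CharP B p]
    (h : Submodule.span K (Set.range fun b : B => b ^ p) = ⊤) : IsReduced B := by
  refine (isReduced_iff_pow_one_lt p (Fact.out : p.Prime).one_lt).mpr fun b hb => ?_
  by_contra hb0
  have hs : LinearIndepOn K id ({b} : Set B) := LinearIndepOn.singleton hb0
  let v := Module.Basis.extend hs
  have hfin : Fintype (hs.extend (Set.subset_univ ({b} : Set B))) :=
    FiniteDimensional.fintypeBasisIndex v
  have hspan : ⊤ ≤ Submodule.span K (Set.range fun i => v i ^ p) := by
    rw [← h, Submodule.span_le]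
    rintro _ ⟨c, rfl⟩
    simp only [SetLike.mem_coe]
    rw [← v.sum_repr c, sum_pow_char]
    refine Submodule.sum_mem _ fun i _ => ?_
    rw [smul_pow]
    exact Submodule.smul_mem _ _ (Submodule.subset_span ⟨i, rfl⟩)
  have hindep : LinearIndependent K fun i => v i ^ p :=
    linearIndependent_of_top_le_span_of_card_eq_finrank hspan (Module.finrank_eq_card_basis v).symm
  refine hindep.ne_zero ⟨b, hs.subset_extend _ (Set.mem_singleton b)⟩ ?_
  simp only [v, Module.Basis.extend_apply_self]
  exact hb

theorem exists_linearEquiv_pi_quotient_maximal {B : Type*} [CommRing B] [IsArtinianRing B]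
    [IsReduced B] (M : Type*) [AddCommGroup M] [Module B M] [Module.Finite B M] :
    ∃ (n : ℕ) (I : Fin n → Ideal B), (∀ i, (I i).IsMaximal) ∧
      Nonempty (M ≃ₗ[B] (∀ i, B ⧸ I i)) := by
  have : IsSemisimpleRing B := IsArtinianRing.isSemisimpleRing_of_isReduced B
  obtain ⟨n, S, e, hS⟩ := IsSemisimpleModule.exists_linearEquiv_fin_dfinsupp B M
  choose I hI hSI using fun i => isSimpleModule_iff_quot_maximal.mp (hS i)
  exact ⟨n, I, hI, ⟨(e.trans DFinsupp.linearEquivFunOnFintype).trans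
    (LinearEquiv.piCongrRight fun i => (hSI i).some)⟩⟩

section Semisimple

variable {B : Type*} [CommRing B] [Algebra K B] [FiniteDimensional K B]
  (M : Type*) [AddCommGroup M] [Module B M] [Module K M] [IsScalarTower K B M] [Module.Finite B M]

theorem exists_frobenius_semilinear [CharP B p]
    (h : Submodule.span K (Set.range fun b : B => b ^ p) = ⊤) :
    ∃ ψ : M →+ M, (∀ (b : B) (m : M), ψ (b • m) = b ^ p • ψ m) ∧
      Submodule.span K (Set.range ψ) = ⊤ := by
  have := isReduced_of_span_range_pow_eq_top p h
  have : IsArtinianRing B := IsArtinianRing.of_finite K B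
  obtain ⟨n, I, hI, ⟨e⟩⟩ := exists_linearEquiv_pi_quotient_maximal (B := B) M
  have hchar : ∀ i, CharP (B ⧸ I i) p := fun i =>
    have := Ideal.Quotient.nontrivial_iff.mpr (hI i).ne_top
    (CharP.charP_iff_prime_eq_zero Fact.out).mpr (by
      rw [← map_natCast (Ideal.Quotient.mk (I i)), CharP.cast_eq_zero, map_zero])
  let ψ : M →+ M :=
    (e.symm : _ →+ M).comp ((piFrobenius p fun i => B ⧸ I i).comp (e : M →+ _))
  have hψ : ∀ m, ψ m = e.symm (piFrobenius p (fun i => B ⧸ I i) (e m)) := fun _ => rfl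
  refine ⟨ψ, fun b m => ?_, ?_⟩
  · rw [hψ, hψ, map_smul, piFrobenius_smul, map_smul]
  · have hrange : Set.range ψ =
        (e.symm.restrictScalars K).toLinearMap '' Set.range (piFrobenius p fun i => B ⧸ I i) := by
      rw [← Set.range_comp, ← e.surjective.range_comp]
      rfl
    rw [hrange, ← Submodule.map_span, span_range_piFrobenius_eq_top p _
      (fun i => Ideal.Quotient.mk_surjective) h, Submodule.map_top, LinearEquiv.range]

variable (K) in
theorem exists_nondegenerate_form_pi {ι : Type*} [Finite ι] (L : ι → Type*)
    [∀ i, CommRing (L i)] [∀ i, Algebra K (L i)] (hL : ∀ i, IsField (L i)) :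
    ∃ β : (∀ i, L i) →ₗ[K] (∀ i, L i) →ₗ[K] K, (∀ f g h, β (f * g) h = β g (f * h)) ∧
      ∀ f, (∀ g, β f g = 0) → f = 0 := by
  classical
  cases nonempty_fintype ι
  have hl : ∀ i, ∃ l : Module.Dual K (L i), l 1 = 1 := fun i =>
    have := (hL i).nontrivial
    Module.Projective.exists_dual_eq_one K one_ne_zero
  choose l hl using hl
  let β : (∀ i, L i) →ₗ[K] (∀ i, L i) →ₗ[K] K :=
    ∑ i, ((LinearMap.mul K (L i)).compr₂ (l i)).compl₁₂ (LinearMap.proj i) (LinearMap.proj i)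
  have hβ : ∀ f g, β f g = ∑ i, l i (f i * g i) := fun f g => by simp [β, LinearMap.sum_apply]
  refine ⟨β, fun f g h => ?_, fun f hf => funext fun i => ?_⟩
  · simp only [hβ, Pi.mul_apply, mul_assoc, mul_left_comm]
  · by_contra hi
    obtain ⟨y, hy⟩ := (hL i).mul_inv_cancel hi
    have hsum := hf (Pi.single i y)
    rw [hβ, Finset.sum_eq_single i (fun j _ hj => by simp [Pi.single_eq_of_ne hj]) (by simp),
      Pi.single_eq_same, hy, hl] at hsum
    exact one_ne_zero hsum

theorem exists_nondegenerate_balanced_form [IsReduced B] :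
    ∃ β : M →ₗ[K] M →ₗ[K] K, (∀ (b : B) (m m' : M), β (b • m) m' = β m (b • m')) ∧
      ∀ m, (∀ m', β m m' = 0) → m = 0 := by
  have : IsArtinianRing B := IsArtinianRing.of_finite K B
  obtain ⟨n, I, hI, ⟨e⟩⟩ := exists_linearEquiv_pi_quotient_maximal (B := B) M
  obtain ⟨β, hβ, hnondeg⟩ := exists_nondegenerate_form_pi K (fun i => B ⧸ I i) fun i =>
    (Ideal.Quotient.maximal_ideal_iff_isField_quotient _).mp (hI i)
  let eK : M →ₗ[K] (∀ i, B ⧸ I i) := (e : M →ₗ[B] _).restrictScalars K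
  refine ⟨β.compl₁₂ eK eK, fun b m m' => ?_, fun m hm => ?_⟩
  · change β (e (b • m)) (e m') = β (e m) (e (b • m'))
    have hsmul : ∀ m, e (b • m) = algebraMap B (∀ i, B ⧸ I i) b * e m := fun m => by
      rw [map_smul, Algebra.smul_def b (e m)]
    rw [hsmul, hsmul, hβ]
  · rw [← e.map_eq_zero_iff]
    refine hnondeg _ fun f => ?_
    obtain ⟨m', rfl⟩ := e.surjective f
    exact hm m'

end Semisimple

variable (K) in
theorem exists_frobenius_and_form (A : Type*) [CommRing A] [Algebra K A] [FiniteDimensional K A]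
    [CharP A p] :
    ∃ s : ℕ, (∃ ψ : A →+ A, (∀ (c : K) (r : A), ψ (c • r) = c ^ p • ψ r) ∧
        (∀ a r : A, ψ (a ^ p ^ s * r) = a ^ p ^ (s + 1) * ψ r) ∧
        Submodule.span K (Set.range ψ) = ⊤) ∧
      ∃ β : A →ₗ[K] A →ₗ[K] K, (∀ a r t : A, β (a ^ p ^ s * r) t = β r (a ^ p ^ s * t)) ∧
        ∀ r, (∀ t, β r t = 0) → r = 0 := by
  obtain ⟨s, hs⟩ := exists_powAdjoin_eq_succ K p A
  let B := powAdjoin K p A s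
  have hB : Submodule.span K (Set.range fun b : B => b ^ p) = ⊤ :=
    span_range_pow_powAdjoin_eq_top p hs
  have : CharP B p := (RingHom.charP_iff B.val.toRingHom Subtype.val_injective p).mpr inferInstance
  have := isReduced_of_span_range_pow_eq_top p hB
  have : Module.Finite B A := Module.Finite.of_restrictScalars_finite K B A
  obtain ⟨ψ, hψ, hspan⟩ := exists_frobenius_semilinear p A hB
  obtain ⟨β, hβ, hnondeg⟩ := exists_nondegenerate_balanced_form (K := K) (B := B) A
  refine ⟨s, ⟨ψ, fun c r => ?_, fun a r => ?_, hspan⟩, β, fun a r t => ?_, hnondeg⟩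
  · have := hψ (algebraMap K B c) r
    rwa [algebraMap_smul, ← map_pow, algebraMap_smul] at this
  · rw [pow_succ, pow_mul]
    exact hψ ⟨_, pow_mem_powAdjoin p s a⟩ r
  · exact hβ ⟨_, pow_mem_powAdjoin p s a⟩ r t

end FrobeniusSpan

/-! ### Dimension counts -/

section LinearAlgebra

variable {k E : Type*} [Field k] [AddCommGroup E] [Module k E]

theorem finrank_quotient_add_le {F : Type*} [AddCommGroup F] [Module k F] {N I : Submodule k E}
    (hNI : N ≤ I) [FiniteDimensional k (E ⧸ N)] (f : F →ₗ[k] E) (hfI : ∀ x, f x ∈ I)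
    (hfN : ∀ x, f x ∈ N → x = 0) :
    Module.finrank k (E ⧸ I) + Module.finrank k F ≤ Module.finrank k (E ⧸ N) := by
  let π : (E ⧸ N) →ₗ[k] (E ⧸ I) := Submodule.factor hNI
  let g : F →ₗ[k] LinearMap.ker π := LinearMap.codRestrict _ (N.mkQ ∘ₗ f) fun x => by
    simpa [π] using hfI x
  have hg : Function.Injective g := by
    rw [injective_iff_map_eq_zero]
    intro x hx
    have := congrArg Subtype.val hx
    exact hfN x (by simpa [g] using this)
  have hrank := LinearMap.finrank_range_add_finrank_ker π
  rw [LinearMap.range_eq_top.mpr (Submodule.factor_surjective hNI), finrank_top] at hrank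
  have hle := LinearMap.finrank_le_finrank_of_injective hg
  omega

theorem finrank_quotient_le_of_le_sup {V Y Z : Submodule k E} (h : Z ≤ Y ⊔ V)
    [FiniteDimensional k (E ⧸ V)] [FiniteDimensional k (E ⧸ Z)] [FiniteDimensional k Y] :
    Module.finrank k (E ⧸ V) ≤ Module.finrank k (E ⧸ Z) + Module.finrank k Y := by
  let π : (E ⧸ V) →ₗ[k] (E ⧸ (Y ⊔ V)) := Submodule.factor le_sup_right
  have hker : LinearMap.ker π ≤ Y.map V.mkQ := by
    intro x hx
    obtain ⟨x, rfl⟩ := V.mkQ_surjective x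
    have hx' : x ∈ Y ⊔ V := by simpa [π] using hx
    obtain ⟨y, hy, v, hv, rfl⟩ := Submodule.mem_sup.mp hx'
    exact ⟨y, hy, by simpa using hv⟩
  have hrank := LinearMap.finrank_range_add_finrank_ker π
  rw [LinearMap.range_eq_top.mpr (Submodule.factor_surjective le_sup_right), finrank_top] at hrank
  have hYV : Module.finrank k (E ⧸ (Y ⊔ V)) ≤ Module.finrank k (E ⧸ Z) :=
    LinearMap.finrank_le_finrank_of_surjective (f := Submodule.factor h)
      (Submodule.factor_surjective h)
  have hY := (Submodule.finrank_mono hker).trans (Submodule.finrank_map_le V.mkQ Y)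
  omega

theorem finrank_quotient_le_finrank_quotient {F : Type*} [AddCommGroup F] [Module k F]
    {Z : Submodule k E} {Y : Submodule k F} [FiniteDimensional k (E ⧸ Z)] {f : E →ₗ[k] F}
    (hf : Function.Surjective f) (hZY : Z ≤ Y.comap f) :
    Module.finrank k (F ⧸ Y) ≤ Module.finrank k (E ⧸ Z) := by
  refine LinearMap.finrank_le_finrank_of_surjective (f := Z.mapQ Y f hZY) ?_
  rw [← LinearMap.range_eq_top, Submodule.range_mapQ, LinearMap.range_eq_top.mpr hf,
    Submodule.map_top, Submodule.range_mkQ]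

theorem finrank_quotient_le_two_mul_of_isotropic {V W : Submodule k E}
    [FiniteDimensional k (E ⧸ V)] [FiniteDimensional k (E ⧸ W)] (L : E →ₗ[k] Module.Dual k E)
    (hL : ∀ v ∈ V, ∀ w ∈ V, L v w = 0) (hker : LinearMap.ker L ≤ W) :
    Module.finrank k (E ⧸ W) ≤ 2 * Module.finrank k (E ⧸ V) := by
  have hV : V.map L ≤ V.dualAnnihilator := by
    rintro _ ⟨v, hv, rfl⟩
    exact (Submodule.mem_dualAnnihilator _).mpr (hL v hv)
  have hann : FiniteDimensional k V.dualAnnihilator :=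
    Module.Finite.equiv V.dualQuotEquivDualAnnihilator
  have hrange : Module.finrank k (V.map L) ≤ Module.finrank k (E ⧸ V) := by
    rw [← Subspace.dual_finrank_eq (V := E ⧸ V), V.dualQuotEquivDualAnnihilator.finrank_eq]
    exact Submodule.finrank_mono hV
  have hfin : FiniteDimensional k (V.map L) := Submodule.finiteDimensional_of_le hV
  obtain ⟨g, hg⟩ := ((LinearMap.ker L).liftQ W.mkQ (by rwa [Submodule.ker_mkQ]) ∘ₗ
    L.quotKerEquivRange.symm.toLinearMap).exists_extend
  have hgL : g ∘ₗ L = W.mkQ := LinearMap.ext fun v => by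
    have := LinearMap.congr_fun hg ⟨L v, v, rfl⟩
    rwa [LinearMap.comp_apply, LinearMap.comp_apply, LinearEquiv.coe_coe,
      LinearMap.quotKerEquivRange_symm_apply_image L v ⟨v, rfl⟩] at this
  have himage : Module.finrank k (V.map W.mkQ) ≤ Module.finrank k (V.map L) := by
    rw [← hgL, Submodule.map_comp]
    exact Submodule.finrank_map_le g _
  have hquot : Module.finrank k ((E ⧸ W) ⧸ V.map W.mkQ) ≤ Module.finrank k (E ⧸ V) :=
    finrank_quotient_le_finrank_quotient W.mkQ_surjective (Submodule.le_comap_map _ _)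
  have hsum := Submodule.finrank_quotient_add_finrank (V.map W.mkQ)
  omega

theorem finrank_quotient_le_of_isotropic {X V Z : Submodule k E} [FiniteDimensional k (E ⧸ X)]
    [FiniteDimensional k (E ⧸ V)] [FiniteDimensional k (E ⧸ Z)] (L : E →ₗ[k] Module.Dual k E)
    (hL : ∀ v ∈ V, ∀ w ∈ V, L v w = 0) (D : E →ₗ[k] E) (hD : ∀ r, L r = 0 → D r ∈ X)
    (hZ : Z ≤ LinearMap.range D ⊔ X) :
    Module.finrank k (E ⧸ X) ≤ 2 * Module.finrank k (E ⧸ V) + Module.finrank k (E ⧸ Z) := by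
  let W := X.comap D
  let D' : (E ⧸ W) →ₗ[k] (E ⧸ X) := W.mapQ X D le_rfl
  have hD' : Function.Injective D' := by
    rw [← LinearMap.ker_eq_bot, Submodule.ker_mapQ, Submodule.mkQ_map_self]
  have : FiniteDimensional k (E ⧸ W) := Module.Finite.of_injective D' hD'
  have hW := finrank_quotient_le_two_mul_of_isotropic (W := W) L hL hD
  have hsurj : Module.finrank k ((E ⧸ X) ⧸ LinearMap.range D') ≤ Module.finrank k (E ⧸ Z) := by
    refine finrank_quotient_le_finrank_quotient X.mkQ_surjective (hZ.trans (sup_le ?_ ?_))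
    · rintro _ ⟨r, rfl⟩
      exact ⟨W.mkQ r, rfl⟩
    · intro x hx
      rw [Submodule.mem_comap, (by simpa using hx : X.mkQ x = 0)]
      exact zero_mem _
  have hrank := Submodule.finrank_quotient_add_finrank (LinearMap.range D')
  rw [LinearMap.finrank_range_of_inj hD'] at hrank
  omega

end LinearAlgebra

section Basis

variable {P R ι : Type*} [CommRing P] [CommRing R] [Algebra P R]

theorem mem_map_algebraMap_iff_repr_mem [Finite ι] (b : Module.Basis ι P R) (I : Ideal P) (r : R) :
    r ∈ I.map (algebraMap P R) ↔ ∀ i, b.repr r i ∈ I := by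
  cases nonempty_fintype ι
  have hsmul : r ∈ I.map (algebraMap P R) ↔ r ∈ I • (⊤ : Submodule P R) := by
    rw [Ideal.smul_top_eq_map]; rfl
  rw [hsmul]
  clear hsmul
  refine ⟨fun hr i => ?_, fun hr => ?_⟩
  · induction hr using Submodule.smul_induction_on' with
    | smul a ha n _ => simpa using I.mul_mem_right _ ha
    | add x _ y _ hx hy => simpa using I.add_mem hx hy
  · rw [← b.sum_repr r]
    exact Submodule.sum_mem _ fun i _ => Submodule.smul_mem_smul (hr i) trivial

variable {k : Type*} [Field k] [Algebra k P] [Algebra k R] [IsScalarTower k P R]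

variable (k) in
/-- The coordinatewise description `R/IR ≃ (P/I)^ι` of the quotient of a free `P`-algebra `R` by an
extended ideal, linear over a subfield `k` of `P`. -/
noncomputable def quotientMapEquiv [Finite ι] (b : Module.Basis ι P R) (I : Ideal P) :
    (R ⧸ I.map (algebraMap P R)) ≃ₗ[k] (ι → P ⧸ I) :=
  let f : R →ₗ[P] (ι → P ⧸ I) := LinearMap.pi fun i => (I.mkQ : P →ₗ[P] P ⧸ I) ∘ₗ b.coord i
  have hf : Function.Surjective f := fun g => by
    cases nonempty_fintype ι
    choose c hc using fun i => Submodule.mkQ_surjective I (g i)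
    refine ⟨∑ j, c j • b j, funext fun i => ?_⟩
    simp only [f, LinearMap.pi_apply, LinearMap.comp_apply, Module.Basis.coord_apply,
      Module.Basis.repr_sum_self]
    exact hc i
  have hker : ((I.map (algebraMap P R)).restrictScalars k) =
      LinearMap.ker (f.restrictScalars k) := by
    ext r
    simp [mem_map_algebraMap_iff_repr_mem b, f, funext_iff, Ideal.Quotient.eq_zero_iff_mem]
  (Submodule.Quotient.restrictScalarsEquiv k (I.map (algebraMap P R))).symm ≪≫ₗ
    Submodule.quotEquivOfEq _ _ hker ≪≫ₗ
    (f.restrictScalars k).quotKerEquivOfSurjective hf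

theorem finrank_quotient_map [Fintype ι] (b : Module.Basis ι P R) (I : Ideal P)
    [FiniteDimensional k (P ⧸ I)] :
    Module.finrank k (R ⧸ I.map (algebraMap P R)) =
      Fintype.card ι * Module.finrank k (P ⧸ I) := by
  rw [(quotientMapEquiv k b I).finrank_eq, Module.finrank_pi_fintype]
  simp

theorem finiteDimensional_quotient_map [Finite ι] (b : Module.Basis ι P R) (I : Ideal P)
    [FiniteDimensional k (P ⧸ I)] :
    FiniteDimensional k (R ⧸ I.map (algebraMap P R)) :=
  Module.Finite.equiv (quotientMapEquiv k b I).symm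

end Basis

/-! ### Monomial ideals of power series rings -/

section MonomialIdeal

open MvPowerSeries

variable {σ k : Type*} [CommRing k]

theorem exists_le_of_mem_span_monomial {S : Set (σ →₀ ℕ)} {f : MvPowerSeries σ k}
    (hf : f ∈ Ideal.span ((fun t => monomial t (1 : k)) '' S)) {α : σ →₀ ℕ}
    (hα : coeff α f ≠ 0) : ∃ t ∈ S, t ≤ α := by
  classical
  induction hf using Submodule.span_induction generalizing α with
  | mem x hx =>
    obtain ⟨t, ht, rfl⟩ := hx
    have hαt : α = t := by
      by_contra h
      simp [coeff_monomial, h] at hα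
    exact ⟨t, ht, hαt.ge⟩
  | zero => simp at hα
  | add x y _ _ hx hy =>
    by_cases h : coeff α x = 0
    · exact hy (by simpa [h] using hα)
    · exact hx h
  | smul c x _ hx =>
    rw [smul_eq_mul, coeff_mul] at hα
    obtain ⟨⟨β, γ⟩, hβγ, h⟩ := Finset.exists_ne_zero_of_sum_ne_zero hα
    obtain ⟨t, ht, htγ⟩ := hx (right_ne_zero_of_mul h)
    rw [Finset.HasAntidiagonal.mem_antidiagonal] at hβγ
    exact ⟨t, ht, htγ.trans (hβγ ▸ le_add_self)⟩

theorem mem_span_monomial_of_forall_exists_le (T : Finset (σ →₀ ℕ)) {f : MvPowerSeries σ k}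
    (hf : ∀ α, coeff α f ≠ 0 → ∃ t ∈ T, t ≤ α) :
    f ∈ Ideal.span ((fun t => monomial t (1 : k)) '' (T : Set (σ →₀ ℕ))) := by
  classical
  induction T using Finset.induction_on generalizing f with
  | empty =>
    have hf0 : f = 0 := MvPowerSeries.ext fun α => by simpa using hf α
    exact hf0 ▸ zero_mem _
  | insert t T _ ih =>
    let g : MvPowerSeries σ k := fun β => coeff (t + β) f
    have hcoeff (α : σ →₀ ℕ) :
        coeff α (f - monomial t (1 : k) * g) = if t ≤ α then 0 else coeff α f := by
      rw [map_sub, coeff_monomial_mul, one_mul]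
      split_ifs with h
      · have hg : coeff (α - t) g = coeff (t + (α - t)) f := rfl
        rw [hg, add_tsub_cancel_of_le h, sub_self]
      · rw [sub_zero]
    have hrest := ih (f := f - monomial t (1 : k) * g) fun α hα => by
      rw [hcoeff] at hα
      split_ifs at hα with h
      · exact absurd rfl hα
      · obtain ⟨t', ht', hle⟩ := hf α hα
        exact ⟨t', Finset.mem_of_mem_insert_of_ne ht' fun h' => h (h' ▸ hle), hle⟩
    rw [← sub_add_cancel f (monomial t (1 : k) * g)]
    refine add_mem (Ideal.span_mono (Set.image_mono ?_) hrest)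
      (Ideal.mul_mem_right _ _ (Ideal.subset_span ⟨t, by simp, rfl⟩))
    simp

theorem mem_span_monomial_iff (T : Finset (σ →₀ ℕ)) (f : MvPowerSeries σ k) :
    f ∈ Ideal.span ((fun t => monomial t (1 : k)) '' (T : Set (σ →₀ ℕ))) ↔
      ∀ α, coeff α f ≠ 0 → ∃ t ∈ T, t ≤ α :=
  ⟨fun hf _ hα => exists_le_of_mem_span_monomial hf hα, mem_span_monomial_of_forall_exists_le T⟩

/-- The coefficients of a power series at the exponents in `G`. -/
def coeffs (k : Type*) [CommRing k] (G : Set (σ →₀ ℕ)) : MvPowerSeries σ k →ₗ[k] (G → k) :=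
  LinearMap.pi fun α => coeff α.1

/-- The power series with prescribed coefficients at the exponents in `G` and all other coefficients
zero. -/
noncomputable def ofCoeffs (k : Type*) [CommRing k] (G : Set (σ →₀ ℕ)) :
    (G → k) →ₗ[k] MvPowerSeries σ k :=
  Function.ExtendByZero.linearMap k (Subtype.val : G → σ →₀ ℕ)

theorem coeff_ofCoeffs_coe {G : Set (σ →₀ ℕ)} (g : G → k) (α : G) :
    coeff α.1 (ofCoeffs k G g) = g α :=
  Subtype.val_injective.extend_apply g (0 : (σ →₀ ℕ) → k) α

theorem coeff_ofCoeffs_of_notMem {G : Set (σ →₀ ℕ)} (g : G → k) {α : σ →₀ ℕ} (hα : α ∉ G) :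
    coeff α (ofCoeffs k G g) = 0 :=
  Function.extend_apply' g (0 : (σ →₀ ℕ) → k) α fun ⟨β, hβ⟩ => hα (hβ ▸ β.2)

theorem coeffs_ofCoeffs (G : Set (σ →₀ ℕ)) (g : G → k) : coeffs k G (ofCoeffs k G g) = g :=
  funext (coeff_ofCoeffs_coe g)

/-- If membership in `I` means vanishing of the coefficients at the exponents in `G`, then the
monomials with exponents in `G` form a basis of the quotient by `I`. -/
noncomputable def quotientEquivCoeffs {I : Ideal (MvPowerSeries σ k)} {G : Set (σ →₀ ℕ)}
    (h : ∀ f, f ∈ I ↔ ∀ α ∈ G, coeff α f = 0) : (MvPowerSeries σ k ⧸ I) ≃ₗ[k] (G → k) :=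
  (Submodule.Quotient.restrictScalarsEquiv k I).symm ≪≫ₗ
    Submodule.quotEquivOfEq _ _ (by
      ext f
      simp [h, coeffs, funext_iff]) ≪≫ₗ
    (coeffs k G).quotKerEquivOfSurjective fun g => ⟨_, coeffs_ofCoeffs G g⟩

theorem finrank_quotient_eq_card_of_mem_iff [Nontrivial k] {I : Ideal (MvPowerSeries σ k)}
    {G : Set (σ →₀ ℕ)} [Finite G] (h : ∀ f, f ∈ I ↔ ∀ α ∈ G, coeff α f = 0) :
    Module.finrank k (MvPowerSeries σ k ⧸ I) = Nat.card G := by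
  cases nonempty_fintype G
  rw [(quotientEquivCoeffs h).finrank_eq, Module.finrank_fintype_fun_eq_card,
    Nat.card_eq_fintype_card]

theorem finite_quotient_of_mem_iff {I : Ideal (MvPowerSeries σ k)} {G : Set (σ →₀ ℕ)} [Finite G]
    (h : ∀ f, f ∈ I ↔ ∀ α ∈ G, coeff α f = 0) : Module.Finite k (MvPowerSeries σ k ⧸ I) :=
  Module.Finite.equiv (quotientEquivCoeffs h).symm

end MonomialIdeal

section VarPow

open MvPowerSeries

variable {d : ℕ}

/-- The exponents bounded strictly by `a`. -/
def exponentBox (a : Fin d → ℕ) : Set (Fin d →₀ ℕ) := {α | ∀ i, α i < a i}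

/-- The tuple of entries of an exponent in a box. -/
noncomputable def exponentBoxEquiv (a : Fin d → ℕ) : exponentBox a ≃ ∀ i, Fin (a i) where
  toFun α i := ⟨α.1 i, α.2 i⟩
  invFun f := ⟨Finsupp.equivFunOnFinite.symm fun i => (f i : ℕ), fun i => by simp⟩
  left_inv α := by ext; simp
  right_inv f := by ext; simp

instance finite_exponentBox (a : Fin d → ℕ) : Finite (exponentBox a) :=
  Finite.of_equiv _ (exponentBoxEquiv a).symm

theorem card_exponentBox (a : Fin d → ℕ) : Nat.card (exponentBox a) = ∏ i, a i := by
  rw [Nat.card_congr (exponentBoxEquiv a), Nat.card_pi]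
  simp

/-- The ideal `(x₁^q, …, x_d^q)` of `k⟦x₁, …, x_d⟧`. -/
noncomputable def varPow (k : Type*) [CommRing k] (d q : ℕ) : Ideal (MvPowerSeries (Fin d) k) :=
  Ideal.span (Set.range fun i => (X i : MvPowerSeries (Fin d) k) ^ q)

section CommRing

variable {k : Type*} [CommRing k]

theorem mem_varPow_iff {q : ℕ} (f : MvPowerSeries (Fin d) k) :
    f ∈ varPow k d q ↔ ∀ α ∈ exponentBox (fun _ : Fin d => q), coeff α f = 0 := by
  classical
  have hspan : (Set.range fun i => (X i : MvPowerSeries (Fin d) k) ^ q) =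
      (fun t => monomial t (1 : k)) ''
        (Finset.univ.image fun i : Fin d => Finsupp.single i q : Finset (Fin d →₀ ℕ)) := by
    ext f
    simp [X_pow_eq]
  rw [varPow, hspan, mem_span_monomial_iff]
  refine forall_congr' fun α => ?_
  rw [not_imp_comm]
  simp [exponentBox]

theorem finrank_quotient_varPow [Nontrivial k] (q : ℕ) :
    Module.finrank k (MvPowerSeries (Fin d) k ⧸ varPow k d q) = q ^ d := by
  rw [finrank_quotient_eq_card_of_mem_iff mem_varPow_iff, card_exponentBox]
  simp

instance finite_quotient_varPow (q : ℕ) :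
    Module.Finite k (MvPowerSeries (Fin d) k ⧸ varPow k d q) :=
  finite_quotient_of_mem_iff mem_varPow_iff

theorem finite_quotient_sup_varPow (I : Ideal (MvPowerSeries (Fin d) k)) (q : ℕ) :
    Module.Finite k (MvPowerSeries (Fin d) k ⧸ (I ⊔ varPow k d q)) :=
  Module.Finite.of_surjective (Ideal.Quotient.factorₐ k le_sup_right).toLinearMap
    (Ideal.Quotient.factor_surjective le_sup_right)

theorem eq_zero_of_forall_mem_varPow {f : MvPowerSeries (Fin d) k}
    (h : ∀ q, q ≠ 0 → f ∈ varPow k d q) : f = 0 := by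
  ext α
  refine (mem_varPow_iff f).mp (h (α.degree + 1) (by omega)) α fun i => ?_
  exact Nat.lt_succ_of_le (Finsupp.le_degree i α)

theorem mul_notMem_varPow [NoZeroDivisors k] {δ f : MvPowerSeries (Fin d) k} {α : Fin d →₀ ℕ}
    (hα : toLex α = lexOrder δ) (hf : f ≠ 0) {q : ℕ}
    (hsupp : ∀ β, coeff β f ≠ 0 → β ∈ exponentBox fun i => q - α i) : δ * f ∉ varPow k d q := by
  classical
  obtain ⟨β, hβ⟩ := exists_finsupp_eq_lexOrder_of_ne_zero hf
  have hlead : toLex (α + β) = lexOrder (δ * f) := by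
    rw [lexOrder_mul, ← hα, hβ]
    rfl
  intro hmem
  refine coeff_ne_zero_of_lexOrder hlead ((mem_varPow_iff _).mp hmem _ fun i => ?_)
  have hβi : β i < q - α i := hsupp β (coeff_ne_zero_of_lexOrder hβ.symm) i
  change α i + β i < q
  omega

end CommRing

theorem pow_card_le_prod_tsub_add {ι : Type*} (s : Finset ι) (a : ι → ℕ) (q : ℕ) :
    q ^ s.card ≤ ∏ i ∈ s, (q - a i) + (∑ i ∈ s, a i) * q ^ (s.card - 1) := by
  classical
  induction s using Finset.induction_on with
  | empty => simp
  | insert j s hj ih =>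
    rw [Finset.card_insert_of_notMem hj, Finset.prod_insert hj, Finset.sum_insert hj,
      Nat.add_sub_cancel]
    have hprod : ∏ i ∈ s, (q - a i) ≤ q ^ s.card :=
      Finset.prod_le_pow_card s _ q fun i _ => Nat.sub_le _ _
    have hsum : q * ((∑ i ∈ s, a i) * q ^ (s.card - 1)) = (∑ i ∈ s, a i) * q ^ s.card := by
      rcases s.eq_empty_or_nonempty with rfl | hs
      · simp
      · rw [mul_left_comm, mul_pow_sub_one hs.card_ne_zero]
    have hq : q ≤ (q - a j) + a j := by omega
    calc q ^ (s.card + 1) = q * q ^ s.card := pow_succ' _ _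
      _ ≤ q * (∏ i ∈ s, (q - a i) + (∑ i ∈ s, a i) * q ^ (s.card - 1)) := by gcongr
      _ = q * ∏ i ∈ s, (q - a i) + (∑ i ∈ s, a i) * q ^ s.card := by rw [mul_add, hsum]
      _ ≤ ((q - a j) + a j) * ∏ i ∈ s, (q - a i) + (∑ i ∈ s, a i) * q ^ s.card := by gcongr
      _ = (q - a j) * ∏ i ∈ s, (q - a i) + a j * ∏ i ∈ s, (q - a i) +
          (∑ i ∈ s, a i) * q ^ s.card := by ring
      _ ≤ (q - a j) * ∏ i ∈ s, (q - a i) + a j * q ^ s.card +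
          (∑ i ∈ s, a i) * q ^ s.card := by gcongr
      _ = (q - a j) * ∏ i ∈ s, (q - a i) + (a j + ∑ i ∈ s, a i) * q ^ s.card := by ring

section Field

variable {k : Type*} [Field k]

theorem exists_finrank_quotient_span_sup_varPow_le {δ : MvPowerSeries (Fin d) k} (hδ : δ ≠ 0) :
    ∃ C : ℕ, ∀ q, Module.finrank k
      (MvPowerSeries (Fin d) k ⧸ (Ideal.span {δ} ⊔ varPow k d q)) ≤ C * q ^ (d - 1) := by
  classical
  obtain ⟨α, hα⟩ := exists_finsupp_eq_lexOrder_of_ne_zero hδ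
  refine ⟨∑ i, α i, fun q => ?_⟩
  let W : Set (Fin d →₀ ℕ) := exponentBox fun i => q - α i
  cases nonempty_fintype W
  let f : (W → k) →ₗ[k] MvPowerSeries (Fin d) k := LinearMap.mulLeft k δ ∘ₗ ofCoeffs k W
  have hf_mem (g : W → k) : f g ∈ Ideal.span {δ} ⊔ varPow k d q :=
    Ideal.mem_sup_left (Ideal.mul_mem_right _ _ (Ideal.mem_span_singleton_self δ))
  have hf_inj (g : W → k) (hg : f g ∈ varPow k d q) : g = 0 := by
    contrapose! hg
    refine mul_notMem_varPow hα.symm ?_ fun β hβ => ?_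
    · exact fun h => hg (by rw [← coeffs_ofCoeffs W g, h, map_zero])
    · by_contra h
      exact hβ (coeff_ofCoeffs_of_notMem g h)
  have : FiniteDimensional k (MvPowerSeries (Fin d) k ⧸ (varPow k d q).restrictScalars k) :=
    finite_quotient_varPow q
  have hle : Module.finrank k (MvPowerSeries (Fin d) k ⧸ (Ideal.span {δ} ⊔ varPow k d q)) +
      Module.finrank k (W → k) ≤ Module.finrank k (MvPowerSeries (Fin d) k ⧸ varPow k d q) :=
    finrank_quotient_add_le (N := (varPow k d q).restrictScalars k)
      (I := (Ideal.span {δ} ⊔ varPow k d q).restrictScalars k)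
      (le_sup_right (a := Ideal.span {δ})) f hf_mem hf_inj
  rw [finrank_quotient_varPow, Module.finrank_fintype_fun_eq_card, ← Nat.card_eq_fintype_card,
    card_exponentBox] at hle
  have hbox := pow_card_le_prod_tsub_add Finset.univ α q
  rw [Finset.card_fin] at hbox
  omega

end Field

end VarPow

section VarIdealPow

open MvPowerSeries

variable {k : Type*} [CommRing k] {d : ℕ}

theorem mem_span_range_X_pow_iff {n : ℕ} (f : MvPowerSeries (Fin d) k) :
    f ∈ (Ideal.span (Set.range X) : Ideal (MvPowerSeries (Fin d) k)) ^ n ↔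
      ∀ α ∈ {α : Fin d →₀ ℕ | α.degree < n}, coeff α f = 0 := by
  have hmap : (Ideal.span (Set.range X) : Ideal (MvPowerSeries (Fin d) k)) =
      (MvPolynomial.idealOfVars (Fin d) k).map MvPolynomial.coeToMvPowerSeries.ringHom := by
    rw [Ideal.map_span, ← Set.range_comp]
    congr 2
    funext i
    simp
  have hT : Finsupp.degree ⁻¹' {n} =
      ((Finset.univ.finsuppAntidiag n : Finset (Fin d →₀ ℕ)) : Set (Fin d →₀ ℕ)) := by
    ext α
    simp [Finset.mem_finsuppAntidiag, Finsupp.degree_eq_sum]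
  have hle (α : Fin d →₀ ℕ) : (∃ t ∈ Finset.univ.finsuppAntidiag n, t ≤ α) ↔ n ≤ α.degree := by
    simp_rw [← Finset.mem_coe, ← hT]
    constructor
    · rintro ⟨t, rfl, ht⟩
      exact Finsupp.degree_mono ht
    · intro hn
      obtain ⟨t, ht, htn⟩ := Finsupp.exists_le_degree_eq α n hn
      exact ⟨t, htn, ht⟩
  rw [hmap, ← Ideal.map_pow, MvPolynomial.pow_idealOfVars_eq_span, Ideal.map_span, Set.image_image]
  simp only [MvPolynomial.coeToMvPowerSeries.ringHom_apply, MvPolynomial.coe_monomial]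
  rw [hT, mem_span_monomial_iff]
  refine forall_congr' fun α => ?_
  rw [hle, not_imp_comm, not_le, Set.mem_ofPred_eq]

theorem setOf_degree_lt_eq (d n : ℕ) : {α : Fin d →₀ ℕ | α.degree < n} =
    ((Finset.range n).biUnion fun i => Finset.univ.finsuppAntidiag i : Finset (Fin d →₀ ℕ)) := by
  ext α
  simp [Finset.mem_finsuppAntidiag, Finsupp.degree_eq_sum]

instance finite_setOf_degree_lt (d n : ℕ) : Finite {α : Fin d →₀ ℕ | α.degree < n} := by
  rw [setOf_degree_lt_eq]
  infer_instance

theorem card_setOf_degree_lt (d n : ℕ) :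
    Nat.card {α : Fin d →₀ ℕ | α.degree < n + 1} = (n + d).choose d := by
  rw [setOf_degree_lt_eq, Nat.card_coe_set_eq, Set.ncard_coe_finset, Finset.card_biUnion]
  · simp only [Finset.card_finsuppAntidiag_nat_eq_multichoose, Finset.card_univ, Fintype.card_fin]
    rw [Nat.sum_range_multichoose]
  · intro i _ j _ hij
    rw [Function.onFun, Finset.disjoint_left]
    intro α hi hj
    rw [Finset.mem_finsuppAntidiag] at hi hj
    exact hij (hi.1.symm.trans hj.1)

theorem finrank_quotient_span_range_X_pow [Nontrivial k] (n : ℕ) :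
    Module.finrank k (MvPowerSeries (Fin d) k ⧸
      (Ideal.span (Set.range X) : Ideal (MvPowerSeries (Fin d) k)) ^ (n + 1)) =
      (n + d).choose d := by
  rw [finrank_quotient_eq_card_of_mem_iff mem_span_range_X_pow_iff, card_setOf_degree_lt]

instance finite_quotient_span_range_X_pow (n : ℕ) : Module.Finite k (MvPowerSeries (Fin d) k ⧸
    (Ideal.span (Set.range X) : Ideal (MvPowerSeries (Fin d) k)) ^ n) :=
  finite_quotient_of_mem_iff mem_span_range_X_pow_iff

end VarIdealPow

/-! ### Clearing denominators -/

section Descent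

open TensorProduct nonZeroDivisors

section Module

variable {P K M N : Type*} [CommRing P] [Field K] [Algebra P K] [AddCommGroup M] [Module P M]
  [AddCommGroup N] [Module P N] [Module K N]

theorem separatingLeft_of_form_fractionRing [IsDomain P] [IsFractionRing P K]
    {inc : M →ₗ[P] N} (hinc : Function.Injective inc)
    (hspan : Submodule.span K (Set.range inc) = ⊤) {β : N →ₗ[K] N →ₗ[K] K}
    (hβ : β.SeparatingLeft) {δ : P} (hδ : δ ≠ 0) {γ : M →ₗ[P] M →ₗ[P] P}
    (hγ : ∀ x y, algebraMap P K (γ x y) = δ • β (inc x) (inc y)) :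
    γ.SeparatingLeft := fun x hx => by
  have hβx : β (inc x) = 0 := LinearMap.ext_on_range hspan fun y => by
    have hxy := hγ x y
    rw [hx, map_zero, eq_comm, Algebra.smul_def, mul_eq_zero] at hxy
    exact hxy.resolve_left ((map_ne_zero_iff _ (IsFractionRing.injective P K)).mpr hδ)
  exact hinc ((hβ _ fun y => by rw [hβx, LinearMap.zero_apply]).trans (map_zero inc).symm)

variable [IsScalarTower P K N]

theorem exists_forall_smul_mem_range_of_semilinear [IsDomain P] [Module.Finite P M]
    (inc : M →ₗ[P] N) [IsLocalizedModule P⁰ inc] (p : ℕ) (ψ : N →+ N)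
    (hψ : ∀ (c : K) (x : N), ψ (c • x) = c ^ p • ψ x) :
    ∃ δ : P, δ ≠ 0 ∧ ∀ x : M, ∃ y : M, inc y = δ • ψ (inc x) := by
  obtain ⟨n, g, hg⟩ := Module.Finite.exists_fin (R := P) (M := M)
  obtain ⟨⟨δ, hδ⟩, hδψ⟩ := IsLocalizedModule.exist_integer_multiples_of_finite P⁰ inc
    fun i => ψ (inc (g i))
  choose m hm using hδψ
  refine ⟨δ, nonZeroDivisors.ne_zero hδ, fun x => ?_⟩
  obtain ⟨c, rfl⟩ := (Submodule.mem_span_range_iff_exists_fun P).mp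
    (hg ▸ Submodule.mem_top (x := x))
  refine ⟨∑ i, c i ^ p • m i, ?_⟩
  simp only [map_sum, Finset.smul_sum, map_smul, hm]
  refine Finset.sum_congr rfl fun i _ => ?_
  rw [← algebraMap_smul K (c i) (inc (g i)), hψ, ← map_pow, algebraMap_smul, smul_comm]

variable [IsFractionRing P K]

theorem span_range_eq_top_of_isLocalizedModule (inc : M →ₗ[P] N) [IsLocalizedModule P⁰ inc] :
    Submodule.span K (Set.range inc) = ⊤ := by
  rw [← Set.image_univ, ← Submodule.top_coe (R := P), ← Submodule.localized'_eq_span K P⁰ inc,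
    Submodule.localized'_top]

theorem exists_smul_mem_of_mem_span_image (inc : M →ₗ[P] N) [IsLocalizedModule P⁰ inc]
    (Y : Submodule P M) {x : M} (hx : inc x ∈ Submodule.span K (inc '' Y)) :
    ∃ c ∈ P⁰, c • x ∈ Y := by
  rw [← Submodule.localized'_eq_span K P⁰ inc Y] at hx
  obtain ⟨y, hy, c, hxy⟩ := hx
  have hcx : inc (c • x) = inc y := by
    rw [Submonoid.smul_def, map_smul, ← hxy]
    exact IsLocalizedModule.mk'_cancel' inc y c
  obtain ⟨c', hc'⟩ := (IsLocalizedModule.eq_iff_exists P⁰ inc).mp hcx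
  refine ⟨c' * c, (c' * c).2, ?_⟩
  rw [mul_smul]
  exact hc' ▸ Y.smul_mem _ hy

theorem exists_forall_smul_mem_of_span_image_eq_top [IsDomain P] [Module.Finite P M]
    (inc : M →ₗ[P] N) [IsLocalizedModule P⁰ inc] (Y : Submodule P M)
    (hY : Submodule.span K (inc '' Y) = ⊤) :
    ∃ δ : P, δ ≠ 0 ∧ ∀ x : M, δ • x ∈ Y := by
  have htorsion : Module.IsTorsion P (M ⧸ Y) := fun x => by
    obtain ⟨x, rfl⟩ := Y.mkQ_surjective x
    obtain ⟨c, hc, hcx⟩ := exists_smul_mem_of_mem_span_image (K := K) inc Y (x := x)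
      (hY ▸ Submodule.mem_top)
    exact ⟨⟨c, hc⟩, (Submodule.Quotient.mk_eq_zero Y).mpr hcx⟩
  obtain ⟨δ, hδ, hδ0⟩ := Submodule.annihilator_top_inter_nonZeroDivisors htorsion
  refine ⟨δ, nonZeroDivisors.ne_zero hδ0, fun x => (Submodule.Quotient.mk_eq_zero Y).mp ?_⟩
  exact Submodule.mem_annihilator.mp hδ (Submodule.Quotient.mk x) trivial

theorem exists_form_of_form_fractionRing [IsDomain P] [Module.Finite P M] (inc : M →ₗ[P] N)
    (β : N →ₗ[K] N →ₗ[K] K) :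
    ∃ (δ : P) (γ : M →ₗ[P] M →ₗ[P] P), δ ≠ 0 ∧
      ∀ x y, algebraMap P K (γ x y) = δ • β (inc x) (inc y) := by
  obtain ⟨n, g, hg⟩ := Module.Finite.exists_fin (R := P) (M := M)
  obtain ⟨⟨δ, hδ⟩, hδβ⟩ := IsLocalization.exist_integer_multiples_of_finite P⁰
    fun i : Fin n × Fin n => β (inc (g i.1)) (inc (g i.2))
  choose m hm using hδβ
  have hsmul (c : P) (x : M) : inc (c • x) = algebraMap P K c • inc x := by
    rw [map_smul, algebraMap_smul]
  have hvalue (x y : M) : ∃ z, algebraMap P K z = δ • β (inc x) (inc y) := by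
    obtain ⟨c, rfl⟩ := (Submodule.mem_span_range_iff_exists_fun P).mp
      (hg ▸ Submodule.mem_top (x := x))
    obtain ⟨c', rfl⟩ := (Submodule.mem_span_range_iff_exists_fun P).mp
      (hg ▸ Submodule.mem_top (x := y))
    refine ⟨∑ j, ∑ i, c i * c' j * m (i, j), ?_⟩
    simp only [map_sum, hsmul, map_smul, LinearMap.sum_apply, LinearMap.smul_apply, map_mul, hm,
      Finset.smul_sum, smul_eq_mul]
    refine Finset.sum_congr rfl fun j _ => ?_
    simp only [Finset.mul_sum, Algebra.smul_def (R := P)]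
    exact Finset.sum_congr rfl fun i _ => by ring
  choose γ hγ using hvalue
  have hinj := IsFractionRing.injective P K
  refine ⟨δ, LinearMap.mk₂ P γ (fun x x' y => hinj ?_) (fun c x y => hinj ?_)
    (fun x y y' => hinj ?_) (fun c x y => hinj ?_), nonZeroDivisors.ne_zero hδ, hγ⟩
  · simp only [hγ, map_add, LinearMap.add_apply, smul_add]
  · simp only [hγ, hsmul, map_smul, LinearMap.smul_apply, smul_eq_mul, map_mul, mul_smul_comm]
  · simp only [hγ, map_add, smul_add]
  · simp only [hγ, hsmul, map_smul, smul_eq_mul, map_mul, mul_smul_comm]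

end Module

theorem exists_ne_zero_forall_exists_eq_mul {P M : Type*} [CommRing P] [IsDomain P]
    [AddCommGroup M] [Module P M] [Module.Free P M] [Module.Finite P M]
    {β : M →ₗ[P] M →ₗ[P] P} (hβ : β.SeparatingLeft) :
    ∃ δ : P, δ ≠ 0 ∧ ∀ f : M →ₗ[P] P, ∃ t, ∀ x, β x t = δ * f x := by
  classical
  let b := Module.Free.chooseBasis P M
  let G := LinearMap.toMatrix₂ b b β
  refine ⟨G.det, Matrix.separatingLeft_iff_det_ne_zero.mp
    ((LinearMap.separatingLeft_toMatrix₂_iff b b).mpr hβ), fun f => ?_⟩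
  -- By Cramer's rule for the Gram matrix `G` of `β`.
  let t : M := b.equivFun.symm (G.adjugate.mulVec fun i => f (b i))
  have hbasis : β.flip t = G.det • f := b.ext fun i => by
    calc β (b i) t
        = (G.mulVec (G.adjugate.mulVec fun i => f (b i))) i := by
          simp [t, G, Module.Basis.equivFun_symm_apply, Matrix.mulVec, dotProduct,
            LinearMap.toMatrix₂_apply, mul_comm]
      _ = G.det * f (b i) := by
          rw [Matrix.mulVec_mulVec, Matrix.mul_adjugate, Matrix.smul_mulVec, Matrix.one_mulVec]
          rfl
  exact ⟨t, fun x => LinearMap.congr_fun hbasis x⟩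

theorem span_range_eq_span_image_of_semilinear {K N : Type*} [Field K] [AddCommGroup N]
    [Module K N] {p : ℕ} {ψ : N →+ N} (hψ : ∀ (c : K) (x : N), ψ (c • x) = c ^ p • ψ x)
    {S : Set N} (hS : Submodule.span K S = ⊤) :
    Submodule.span K (Set.range ψ) = Submodule.span K (ψ '' S) := by
  refine le_antisymm (Submodule.span_le.mpr ?_) (Submodule.span_mono (Set.image_subset_range ψ S))
  rintro _ ⟨x, rfl⟩
  have hx : x ∈ Submodule.span K S := hS ▸ Submodule.mem_top
  induction hx using Submodule.span_induction with
  | mem x hx => exact Submodule.subset_span ⟨x, hx, rfl⟩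
  | zero => rw [map_zero]; exact Submodule.zero_mem _
  | add x y _ _ hx hy => rw [map_add]; exact Submodule.add_mem _ hx hy
  | smul c x _ hx => rw [hψ]; exact Submodule.smul_mem _ _ hx

section Algebra

variable (p : ℕ) {P R : Type*} [CommRing P] [IsDomain P] [CommRing R] [Algebra P R]
  [Module.Finite P R]

theorem exists_integral_frobenius {K A : Type*} [Field K] [Algebra P K] [IsFractionRing P K]
    [CommRing A] [Algebra P A] [Algebra K A] [IsScalarTower P K A] {inc : R →ₐ[P] A}
    [IsLocalizedModule P⁰ inc.toLinearMap] (hinj : Function.Injective inc) {s : ℕ} {ψ' : A →+ A}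
    (hsmul : ∀ (c : K) (r : A), ψ' (c • r) = c ^ p • ψ' r)
    (hpow : ∀ a r, ψ' (a ^ p ^ s * r) = a ^ p ^ (s + 1) * ψ' r)
    (hspan : Submodule.span K (Set.range ψ') = ⊤) :
    ∃ ψ : R →+ R, (∀ (c : P) (r : R), ψ (c • r) = c ^ p • ψ r) ∧
      (∀ a r : R, ψ (a ^ p ^ s * r) = a ^ p ^ (s + 1) * ψ r) ∧
      ∃ δ : P, δ ≠ 0 ∧ ∀ r : R, δ • r ∈ Submodule.span P (Set.range ψ) := by
  obtain ⟨ε, hε, hψ'⟩ := exists_forall_smul_mem_range_of_semilinear (K := K) inc.toLinearMap p ψ'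
    hsmul
  choose ψ₀ hψ₀ using hψ'
  replace hψ₀ (r : R) : inc (ψ₀ r) = ε • ψ' (inc r) := hψ₀ r
  let ψ : R →+ R := AddMonoidHom.mk' ψ₀ fun a b => hinj <| by
    simp only [hψ₀, map_add, smul_add]
  have hψ (r : R) : inc (ψ r) = ε • ψ' (inc r) := hψ₀ r
  refine ⟨ψ, fun c r => hinj ?_, fun a r => hinj ?_,
    exists_forall_smul_mem_of_span_image_eq_top (K := K) inc.toLinearMap _ ?_⟩
  · rw [hψ, map_smul, ← algebraMap_smul K c, hsmul, map_smul, hψ, ← map_pow, algebraMap_smul,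
      smul_comm]
  · rw [hψ, map_mul, map_pow, hpow, map_mul, map_pow, hψ, mul_smul_comm]
  · rw [eq_top_iff, ← hspan, span_range_eq_span_image_of_semilinear hsmul
      (span_range_eq_top_of_isLocalizedModule inc.toLinearMap), Submodule.span_le]
    rintro _ ⟨_, ⟨r, rfl⟩, rfl⟩
    have hr : ψ' (inc r) = (algebraMap P K ε)⁻¹ • inc (ψ r) := by
      rw [hψ, ← algebraMap_smul K ε, smul_smul, inv_mul_cancel₀, one_smul]
      exact (map_ne_zero_iff _ (IsFractionRing.injective P K)).mpr hε
    exact hr ▸ Submodule.smul_mem _ _ (Submodule.subset_span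
      ⟨ψ r, Submodule.subset_span ⟨r, rfl⟩, rfl⟩)

variable [Fact p.Prime] [CharP P p] [Module.Free P R] [Nontrivial R]

theorem exists_integral_frobenius_and_form :
    ∃ s : ℕ, (∃ ψ : R →+ R, (∀ (c : P) (r : R), ψ (c • r) = c ^ p • ψ r) ∧
        (∀ a r : R, ψ (a ^ p ^ s * r) = a ^ p ^ (s + 1) * ψ r) ∧
        ∃ δ : P, δ ≠ 0 ∧ ∀ r : R, δ • r ∈ Submodule.span P (Set.range ψ)) ∧
      ∃ β : R →ₗ[P] R →ₗ[P] P, (∀ a r t : R, β (a ^ p ^ s * r) t = β r (a ^ p ^ s * t)) ∧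
        ∃ δ : P, δ ≠ 0 ∧ ∀ f : R →ₗ[P] P, ∃ t, ∀ r, β r t = δ * f r := by
  let K := FractionRing P
  let A := K ⊗[P] R
  let inc : R →ₐ[P] A := Algebra.TensorProduct.includeRight
  have hinj : Function.Injective inc :=
    Algebra.TensorProduct.includeRight_injective (IsFractionRing.injective P K)
  have : IsLocalizedModule P⁰ inc.toLinearMap :=
    inferInstanceAs (IsLocalizedModule P⁰ (TensorProduct.mk P K R 1))
  have : Nontrivial A := hinj.nontrivial
  have hCK : CharP K p := charP_of_injective_algebraMap (IsFractionRing.injective P K) p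
  have hCA : CharP A p := charP_of_injective_algebraMap (algebraMap K A).injective p
  obtain ⟨s, ⟨ψ, hsmul, hpow, hψspan⟩, β', hβ'bal, hβ'⟩ := exists_frobenius_and_form K p A
  refine ⟨s, exists_integral_frobenius p hinj hsmul hpow hψspan, ?_⟩
  obtain ⟨ε, β, hε, hβ⟩ := exists_form_of_form_fractionRing inc.toLinearMap β'
  replace hβ (x y : R) : algebraMap P K (β x y) = ε • β' (inc x) (inc y) := hβ x y
  refine ⟨β, fun a r t => IsFractionRing.injective P K ?_, exists_ne_zero_forall_exists_eq_mul
    (separatingLeft_of_form_fractionRing hinj ?_ hβ' hε hβ)⟩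
  · rw [hβ, hβ, map_mul inc, map_pow inc, hβ'bal, map_mul inc, map_pow inc]
  · exact span_range_eq_top_of_isLocalizedModule inc.toLinearMap

end Algebra

end Descent

/-! ### Hilbert–Kunz multiplicities of free algebras over power series rings -/

section PowSpan

variable {R : Type*} [CommRing R]

/-- The ideal generated by the `q`-th powers of the elements of `S`; for an ideal `S = I` it is the
Frobenius power `I^[q]`. -/
def powSpan (S : Set R) (q : ℕ) : Ideal R := Ideal.span ((fun a => a ^ q) '' S)

theorem map_mem_powSpan_mul {ψ : R →+ R} {p q : ℕ}
    (hψ : ∀ a r : R, ψ (a ^ q * r) = a ^ (p * q) * ψ r) {S : Set R} {v : R}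
    (hv : v ∈ powSpan S q) : ψ v ∈ powSpan S (p * q) := by
  induction hv using Submodule.closure_induction with
  | zero => rw [map_zero]; exact zero_mem _
  | add x y _ _ hx hy => rw [map_add]; exact add_mem hx hy
  | smul_mem r x hx =>
    obtain ⟨a, ha, rfl⟩ := hx
    rw [smul_eq_mul, mul_comm r, hψ]
    exact Ideal.mul_mem_right _ _ (Ideal.subset_span ⟨a, ha, rfl⟩)

variable {P : Type*} [CommRing P] [Algebra P R] {I : Ideal P}

theorem apply_mem_of_mem_map_algebraMap (f : R →ₗ[P] P) {x : R}
    (hx : x ∈ I.map (algebraMap P R)) : f x ∈ I := by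
  induction hx using Submodule.closure_induction with
  | zero => rw [map_zero]; exact zero_mem _
  | add x y _ _ hx hy => rw [map_add]; exact add_mem hx hy
  | smul_mem r x hx =>
    obtain ⟨c, hc, rfl⟩ := hx
    rw [smul_eq_mul, mul_comm r, ← Algebra.smul_def, map_smul]
    exact Ideal.mul_mem_right _ _ hc

theorem exists_eq_smul_add_of_mem_map_span_singleton_sup {δ : P} {x : R}
    (hx : x ∈ (Ideal.span {δ} ⊔ I).map (algebraMap P R)) :
    ∃ t, ∃ v ∈ I.map (algebraMap P R), x = δ • t + v := by
  rw [Ideal.map_sup, Ideal.map_span, Set.image_singleton, Submodule.mem_sup] at hx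
  obtain ⟨u, hu, v, hv, rfl⟩ := hx
  obtain ⟨t, rfl⟩ := Ideal.mem_span_singleton'.mp hu
  exact ⟨t, v, hv, by rw [Algebra.smul_def, mul_comm]⟩

theorem powSpan_isotropic {β : R →ₗ[P] R →ₗ[P] P} {S : Set R} {q : ℕ}
    (hβ : ∀ a r t, β (a ^ q * r) t = β r (a ^ q * t))
    (hS : ∀ a ∈ S, ∀ c ∈ S, a ^ q * c ^ q ∈ I.map (algebraMap P R)) {v w : R}
    (hv : v ∈ powSpan S q) (hw : w ∈ powSpan S q) : β v w ∈ I := by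
  have hmul : powSpan S q * powSpan S q ≤ I.map (algebraMap P R) := by
    rw [powSpan, Ideal.span_mul_span', Ideal.span_le]
    rintro _ ⟨_, ⟨a, ha, rfl⟩, _, ⟨c, hc, rfl⟩, rfl⟩
    exact hS a ha c hc
  induction hw using Submodule.closure_induction with
  | zero => rw [map_zero]; exact zero_mem _
  | add x y _ _ hx hy => rw [map_add]; exact add_mem hx hy
  | smul_mem r x hx =>
    obtain ⟨c, hc, rfl⟩ := hx
    rw [smul_eq_mul, mul_comm r, ← hβ]
    exact apply_mem_of_mem_map_algebraMap (β.flip r)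
      (hmul (Ideal.mul_mem_mul (Ideal.subset_span ⟨c, hc, rfl⟩) hv))

end PowSpan

section HilbertKunz

open MvPowerSeries

variable {k : Type*} [Field k] {d : ℕ}

theorem eq_top_of_varPow_le_of_monomial_mem {q : ℕ} {W : Submodule k (MvPowerSeries (Fin d) k)}
    (hq : (varPow k d q).restrictScalars k ≤ W) (hmonomial : ∀ γ, monomial γ (1 : k) ∈ W) :
    W = ⊤ := by
  classical
  have := Fintype.ofFinite (exponentBox fun _ : Fin d => q)
  refine eq_top_iff.mpr fun c _ => ?_
  let T := ∑ γ : exponentBox fun _ : Fin d => q, coeff γ.1 c • monomial γ.1 (1 : k)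
  have hT : T ∈ W := Submodule.sum_mem _ fun γ _ => W.smul_mem _ (hmonomial γ)
  have hsub : c - T ∈ varPow k d q := by
    refine (mem_varPow_iff _).mpr fun α hα => ?_
    rw [map_sub, map_sum, Finset.sum_eq_single ⟨α, hα⟩, map_smul, coeff_monomial_same,
      smul_eq_mul, mul_one, sub_self]
    · intro γ _ hγ
      rw [map_smul, coeff_monomial_ne (fun h => hγ (Subtype.ext h.symm)), smul_zero]
    · exact fun h => absurd (Finset.mem_univ _) h
  exact sub_add_cancel c T ▸ W.add_mem (hq hsub) hT

/-- Modulo `(x₁^q, …, x_d^q)` the socle of the power series ring is spanned by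
`(x₁ ⋯ x_d)^(q-1)`. -/
theorem mem_varPow_of_forall_coeff_mul_eq_zero {q : ℕ} {g : MvPowerSeries (Fin d) k}
    (h : ∀ f, coeff (Finsupp.equivFunOnFinite.symm fun _ => q - 1) (f * g) = 0) :
    g ∈ varPow k d q := by
  refine (mem_varPow_iff g).mpr fun α hα => ?_
  set τ : Fin d →₀ ℕ := Finsupp.equivFunOnFinite.symm fun _ => q - 1
  have hατ : α ≤ τ := fun i => Nat.le_sub_one_of_lt (hα i)
  have hα' := h (monomial (τ - α) 1)
  rwa [coeff_monomial_mul, if_pos tsub_le_self, one_mul, tsub_tsub_cancel_of_le hατ] at hα'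

variable {R : Type*} [CommRing R] [Algebra (MvPowerSeries (Fin d) k) R]

theorem map_varPow_le_powSpan {S : Set R}
    (hS : ∀ i, algebraMap (MvPowerSeries (Fin d) k) R (X i) ∈ S) (q : ℕ) :
    (varPow k d q).map (algebraMap (MvPowerSeries (Fin d) k) R) ≤ powSpan S q := by
  rw [varPow, Ideal.map_span, Ideal.span_le]
  rintro _ ⟨_, ⟨i, rfl⟩, rfl⟩
  exact Ideal.subset_span ⟨_, hS i, (map_pow _ _ _).symm⟩

variable [Algebra k R]

theorem monomial_smul_mem_of_forall_exponentBox {p : ℕ} (hp : p ≠ 0) {ψ : R →+ R}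
    (hψ : ∀ (c : MvPowerSeries (Fin d) k) (r : R), ψ (c • r) = c ^ p • ψ r) {D : Submodule k R}
    (hD : ∀ α ∈ exponentBox fun _ : Fin d => p, ∀ x, monomial α (1 : k) • ψ x ∈ D)
    (γ : Fin d →₀ ℕ) (x : R) : monomial γ (1 : k) • ψ x ∈ D := by
  let quot : Fin d →₀ ℕ := Finsupp.equivFunOnFinite.symm fun i => γ i / p
  let rem : Fin d →₀ ℕ := Finsupp.equivFunOnFinite.symm fun i => γ i % p
  have hγ : γ = rem + p • quot := by
    ext i
    simp [rem, quot, Nat.mod_add_div]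
  have hx : monomial γ (1 : k) • ψ x = monomial rem (1 : k) • ψ (monomial quot (1 : k) • x) := by
    rw [hψ, smul_smul, monomial_pow, monomial_mul_monomial, one_pow, mul_one, ← hγ]
  exact hx ▸ hD rem (fun i => Nat.mod_lt _ (Nat.pos_of_ne_zero hp)) _

variable [IsScalarTower k (MvPowerSeries (Fin d) k) R]

theorem exists_finrank_le_forall_smul_mem_sup {p : ℕ} (hp : p ≠ 0) {ψ : R →+ R}
    (hψ : ∀ (c : MvPowerSeries (Fin d) k) (r : R), ψ (c • r) = c ^ p • ψ r) {U : Submodule k R}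
    [FiniteDimensional k (R ⧸ U)] {V : Ideal R} (hUV : ∀ u ∈ U, ψ u ∈ V) {q : ℕ}
    (hV : (varPow k d q).map (algebraMap (MvPowerSeries (Fin d) k) R) ≤ V) :
    ∃ Y : Submodule k R, FiniteDimensional k Y ∧
      Module.finrank k Y ≤ p ^ d * Module.finrank k (R ⧸ U) ∧
      ∀ (c : MvPowerSeries (Fin d) k) (x : R), c • ψ x ∈ Y ⊔ V.restrictScalars k := by
  have := Fintype.ofFinite (exponentBox fun _ : Fin d => p)
  let e := Module.finBasis k (R ⧸ U)
  choose r hr using fun i => Submodule.mkQ_surjective U (e i)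
  have hr_top : U ⊔ Submodule.span k (Set.range r) = ⊤ := by
    rw [← Submodule.map_mkQ_eq_top, Submodule.map_span, ← Set.range_comp, ← e.span_eq]
    exact congrArg _ (congrArg _ (funext hr))
  let y (j : (exponentBox fun _ : Fin d => p) × Fin _) : R := monomial j.1.1 (1 : k) • ψ (r j.2)
  let D := Submodule.span k (Set.range y) ⊔ V.restrictScalars k
  refine ⟨_, FiniteDimensional.span_of_finite k (Set.finite_range y), ?_, fun c x => ?_⟩
  · refine (finrank_range_le_card y).trans_eq ?_
    rw [Fintype.card_prod, ← Nat.card_eq_fintype_card, card_exponentBox, Finset.prod_const,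
      Finset.card_univ, Fintype.card_fin, Fintype.card_fin]
  have hbox : ∀ α ∈ exponentBox fun _ : Fin d => p, ∀ x, monomial α (1 : k) • ψ x ∈ D := by
    intro α hα x
    obtain ⟨u, hu, v, hv, rfl⟩ := Submodule.mem_sup.mp (hr_top ▸ Submodule.mem_top : x ∈ _)
    rw [map_add, smul_add]
    refine add_mem (Submodule.mem_sup_right
      (Submodule.smul_of_tower_mem (V.restrictScalars (MvPowerSeries (Fin d) k)) _ (hUV u hu))) ?_
    induction hv using Submodule.span_induction with
    | mem _ hv =>
      obtain ⟨i, rfl⟩ := hv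
      exact Submodule.mem_sup_left (Submodule.subset_span ⟨(⟨α, hα⟩, i), rfl⟩)
    | zero => simp only [map_zero, smul_zero, zero_mem]
    | add _ _ _ _ hx hy => rw [map_add, smul_add]; exact add_mem hx hy
    | smul c v _ hv =>
      rw [← algebraMap_smul (MvPowerSeries (Fin d) k) c, hψ, ← map_pow, algebraMap_smul, smul_comm]
      exact D.smul_mem _ hv
  let W := D.comap ((LinearMap.toSpanSingleton (MvPowerSeries (Fin d) k) R (ψ x)).restrictScalars k)
  have hW : W = ⊤ := eq_top_of_varPow_le_of_monomial_mem
    (fun f hf => Submodule.mem_sup_right (hV (by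
      simpa [Algebra.smul_def] using Ideal.mul_mem_right _ _ (Ideal.mem_map_of_mem _ hf))))
    fun γ => monomial_smul_mem_of_forall_exponentBox hp hψ hbox γ x
  exact (hW ▸ Submodule.mem_top : c ∈ W)

variable {ι : Type*}

theorem finiteDimensional_quotient_powSpan [Finite ι]
    (b : Module.Basis ι (MvPowerSeries (Fin d) k) R) {S : Set R}
    (hS : ∀ i, algebraMap (MvPowerSeries (Fin d) k) R (X i) ∈ S) (q : ℕ) :
    FiniteDimensional k (R ⧸ powSpan S q) :=
  have := finiteDimensional_quotient_map (k := k) b (varPow k d q)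
  Module.Finite.of_surjective
    (Ideal.Quotient.factorₐ k (map_varPow_le_powSpan hS q)).toLinearMap
    (Ideal.Quotient.factor_surjective (map_varPow_le_powSpan hS q))

variable [Fintype ι]

theorem finrank_quotient_powSpan_mul_le {p q : ℕ} (hp : p ≠ 0)
    (b : Module.Basis ι (MvPowerSeries (Fin d) k) R)
    {S : Set R} (hS : ∀ i, algebraMap (MvPowerSeries (Fin d) k) R (X i) ∈ S) {ψ : R →+ R}
    (hψ_smul : ∀ (c : MvPowerSeries (Fin d) k) (r : R), ψ (c • r) = c ^ p • ψ r)
    (hψ_pow : ∀ a r : R, ψ (a ^ q * r) = a ^ (p * q) * ψ r) {δ : MvPowerSeries (Fin d) k}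
    (hδ : ∀ r, δ • r ∈ Submodule.span (MvPowerSeries (Fin d) k) (Set.range ψ)) :
    Module.finrank k (R ⧸ powSpan S (p * q)) ≤ p ^ d * Module.finrank k (R ⧸ powSpan S q) +
      Fintype.card ι * Module.finrank k
        (MvPowerSeries (Fin d) k ⧸ (Ideal.span {δ} ⊔ varPow k d (p * q))) := by
  let V := (powSpan S (p * q)).restrictScalars k
  let Z := ((Ideal.span {δ} ⊔ varPow k d (p * q)).map
    (algebraMap (MvPowerSeries (Fin d) k) R)).restrictScalars k
  have : FiniteDimensional k (R ⧸ (powSpan S q).restrictScalars k) :=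
    finiteDimensional_quotient_powSpan b hS q
  have : FiniteDimensional k (R ⧸ V) := finiteDimensional_quotient_powSpan b hS (p * q)
  have := finite_quotient_sup_varPow (Ideal.span {δ}) (p * q)
  have : FiniteDimensional k (R ⧸ Z) := finiteDimensional_quotient_map b _
  obtain ⟨Y, _, hY, hYV⟩ := exists_finrank_le_forall_smul_mem_sup hp hψ_smul
    (U := (powSpan S q).restrictScalars k) (fun _ => map_mem_powSpan_mul hψ_pow)
    (map_varPow_le_powSpan hS (p * q))
  have hZ : Z ≤ Y ⊔ V := by
    intro x hx
    obtain ⟨t, v, hv, rfl⟩ := exists_eq_smul_add_of_mem_map_span_singleton_sup hx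
    refine add_mem ?_ (Submodule.mem_sup_right (map_varPow_le_powSpan hS _ hv))
    obtain ⟨c, hc⟩ := Finsupp.mem_span_range_iff_exists_finsupp.mp (hδ t)
    exact hc ▸ Submodule.sum_mem _ fun i _ => hYV _ _
  calc Module.finrank k (R ⧸ V)
      ≤ Module.finrank k (R ⧸ Z) + Module.finrank k Y := finrank_quotient_le_of_le_sup hZ
    _ = Fintype.card ι * _ + Module.finrank k Y := by
      congr 1
      exact finrank_quotient_map b _
    _ ≤ _ := by rw [add_comm]; exact Nat.add_le_add_right hY _

theorem card_mul_pow_le_finrank_quotient_powSpan {q : ℕ} (hq : q ≠ 0)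
    (b : Module.Basis ι (MvPowerSeries (Fin d) k) R)
    {S : Set R} (hS : ∀ i, algebraMap (MvPowerSeries (Fin d) k) R (X i) ∈ S)
    {β : R →ₗ[MvPowerSeries (Fin d) k] R →ₗ[MvPowerSeries (Fin d) k] MvPowerSeries (Fin d) k}
    (hβ : ∀ a r t, β (a ^ q * r) t = β r (a ^ q * t)) {δ : MvPowerSeries (Fin d) k}
    (hδ : ∀ f : R →ₗ[MvPowerSeries (Fin d) k] MvPowerSeries (Fin d) k,
      ∃ t, ∀ r, β r t = δ * f r)
    (hSS : ∀ a ∈ S, ∀ c ∈ S,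
      a ^ q * c ^ q ∈ (varPow k d q).map (algebraMap (MvPowerSeries (Fin d) k) R)) :
    Fintype.card ι * q ^ d ≤ 2 * Module.finrank k (R ⧸ powSpan S q) +
      Fintype.card ι * Module.finrank k
        (MvPowerSeries (Fin d) k ⧸ (Ideal.span {δ} ⊔ varPow k d q)) := by
  let τ : Fin d →₀ ℕ := Finsupp.equivFunOnFinite.symm fun _ => q - 1
  have hτ : τ ∈ exponentBox fun _ : Fin d => q := fun _ => Nat.sub_one_lt hq
  let X' := ((varPow k d q).map (algebraMap (MvPowerSeries (Fin d) k) R)).restrictScalars k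
  let V := (powSpan S q).restrictScalars k
  let Z := ((Ideal.span {δ} ⊔ varPow k d q).map
    (algebraMap (MvPowerSeries (Fin d) k) R)).restrictScalars k
  have : FiniteDimensional k (R ⧸ X') := finiteDimensional_quotient_map b _
  have : FiniteDimensional k (R ⧸ V) := finiteDimensional_quotient_powSpan b hS q
  have := finite_quotient_sup_varPow (Ideal.span {δ}) q
  have : FiniteDimensional k (R ⧸ Z) := finiteDimensional_quotient_map b _
  let L : R →ₗ[k] Module.Dual k R := LinearMap.mk₂ k (fun r t => coeff τ (β r t))
    (fun r r' t => by simp) (fun c r t => by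
      rw [LinearMap.map_smul_of_tower, LinearMap.smul_apply, map_smul])
    (fun r t t' => by simp) (fun c r t => by
      rw [LinearMap.map_smul_of_tower, map_smul])
  have hL : ∀ v ∈ V, ∀ w ∈ V, L v w = 0 := fun v hv w hw =>
    (mem_varPow_iff _).mp (powSpan_isotropic hβ hSS hv hw) τ hτ
  let D : R →ₗ[k] R := (LinearMap.lsmul (MvPowerSeries (Fin d) k) R δ).restrictScalars k
  have hD : ∀ r, L r = 0 → D r ∈ X' := fun r hr => by
    refine (mem_map_algebraMap_iff_repr_mem b _ _).mpr fun i => ?_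
    obtain ⟨t, ht⟩ := hδ (b.coord i)
    have hrepr : b.repr (D r) i = β r t := by simp [D, ht]
    rw [hrepr]
    refine mem_varPow_of_forall_coeff_mul_eq_zero fun f => ?_
    rw [← smul_eq_mul, ← map_smul]
    exact LinearMap.congr_fun hr (f • t)
  have hZ : Z ≤ LinearMap.range D ⊔ X' := by
    intro x hx
    obtain ⟨t, v, hv, rfl⟩ := exists_eq_smul_add_of_mem_map_span_singleton_sup hx
    exact Submodule.add_mem_sup ⟨t, rfl⟩ hv
  calc Fintype.card ι * q ^ d
      = Module.finrank k (R ⧸ X') := by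
        rw [← finrank_quotient_varPow (k := k), ← finrank_quotient_map b]; rfl
    _ ≤ 2 * Module.finrank k (R ⧸ V) + Module.finrank k (R ⧸ Z) :=
        finrank_quotient_le_of_isotropic L hL D hD hZ
    _ = _ := by
      congr 1
      exact finrank_quotient_map b _

end HilbertKunz

section Limits

theorem exists_tendsto_of_le_add_geometric {a : ℕ → ℝ} (ha : ∀ n, 0 ≤ a n) {C r : ℝ}
    (hr0 : 0 ≤ r) (hr1 : r < 1) {s : ℕ} (h : ∀ n, s ≤ n → a (n + 1) ≤ a n + C * r ^ n) :
    ∃ L, Tendsto a atTop (𝓝 L) := by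
  let D := C / (1 - r)
  have hD : C = D * (1 - r) := (div_mul_cancel₀ C (sub_pos.mpr hr1).ne').symm
  let u (n : ℕ) : ℝ := a (n + s) + D * r ^ (n + s)
  have hgeom : Tendsto (fun n : ℕ => D * r ^ (n + s)) atTop (𝓝 0) := by
    simpa using ((tendsto_pow_atTop_nhds_zero_of_lt_one hr0 hr1).comp
      (tendsto_add_atTop_nat s)).const_mul D
  have hu_anti : Antitone u := antitone_nat_of_succ_le fun n => by
    have hn := h (n + s) (Nat.le_add_left s n)
    simp only [u, Nat.add_right_comm n 1 s, pow_succ]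
    rw [hD] at hn
    linarith
  have hu_bdd : BddBelow (Set.range u) := by
    obtain ⟨m, hm⟩ := hgeom.bddBelow_range
    refine ⟨m, ?_⟩
    rintro _ ⟨n, rfl⟩
    exact (hm ⟨n, rfl⟩).trans (le_add_of_nonneg_left (ha _))
  refine ⟨⨅ i, u i, (tendsto_add_atTop_iff_nat s).mp ?_⟩
  simpa [u] using (tendsto_atTop_ciInf hu_anti hu_bdd).sub hgeom

variable {p d C s : ℕ} {f : ℕ → ℕ}

theorem exists_tendsto_div_pow_of_le (hp : 1 < p) (hd : d ≠ 0)
    (hf : ∀ t, s ≤ t → f (t + 1) ≤ p ^ d * f t + C * (p ^ (t + 1)) ^ (d - 1)) :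
    ∃ L : ℝ, Tendsto (fun t => (f t : ℝ) / ((p ^ t : ℕ) : ℝ) ^ d) atTop (𝓝 L) := by
  obtain ⟨n, rfl⟩ := Nat.exists_eq_succ_of_ne_zero hd
  have hp0 : (0 : ℝ) < p := by exact_mod_cast hp.pos
  have hp1 : (p : ℝ)⁻¹ < 1 := inv_lt_one_of_one_lt₀ (by exact_mod_cast hp)
  refine exists_tendsto_of_le_add_geometric (C := C / p) (s := s) (fun t => by positivity)
    (inv_nonneg.mpr hp0.le) hp1
    fun t ht => ?_
  have hft : (f (t + 1) : ℝ) ≤ p ^ (n + 1) * f t + C * (p ^ (t + 1)) ^ n := by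
    exact_mod_cast hf t ht
  push_cast
  calc (f (t + 1) : ℝ) / ((p : ℝ) ^ (t + 1)) ^ (n + 1)
      ≤ (p ^ (n + 1) * f t + C * (p ^ (t + 1)) ^ n) / ((p : ℝ) ^ (t + 1)) ^ (n + 1) := by gcongr
    _ = f t / ((p : ℝ) ^ t) ^ (n + 1) + C / p * (p : ℝ)⁻¹ ^ t := by
        rw [inv_pow]; field_simp; ring

theorem half_le_of_tendsto_div_pow {e : ℕ} {L : ℝ} (hp : 1 < p) (hd : d ≠ 0)
    (hf : ∀ t, s ≤ t → e * (p ^ t) ^ d ≤ 2 * f t + C * (p ^ t) ^ (d - 1))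
    (hL : Tendsto (fun t => (f t : ℝ) / ((p ^ t : ℕ) : ℝ) ^ d) atTop (𝓝 L)) :
    (e : ℝ) / 2 ≤ L := by
  obtain ⟨n, rfl⟩ := Nat.exists_eq_succ_of_ne_zero hd
  have hp0 : (0 : ℝ) < p := by exact_mod_cast hp.pos
  have hp1 : (p : ℝ)⁻¹ < 1 := inv_lt_one_of_one_lt₀ (by exact_mod_cast hp)
  have hlow : Tendsto (fun t : ℕ => (e : ℝ) / 2 - C / 2 * (p : ℝ)⁻¹ ^ t) atTop
      (𝓝 ((e : ℝ) / 2)) := by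
    simpa using ((tendsto_pow_atTop_nhds_zero_of_lt_one (inv_nonneg.mpr hp0.le) hp1).const_mul
      ((C : ℝ) / 2)).const_sub ((e : ℝ) / 2)
  refine le_of_tendsto_of_tendsto hlow hL (eventually_atTop.mpr ⟨s, fun t ht => ?_⟩)
  have hft : (e : ℝ) * (p ^ t) ^ (n + 1) ≤ 2 * f t + C * (p ^ t) ^ n := by exact_mod_cast hf t ht
  push_cast
  calc (e : ℝ) / 2 - C / 2 * (p : ℝ)⁻¹ ^ t
      = (e * (p ^ t) ^ (n + 1) - C * (p ^ t) ^ n) / 2 / ((p : ℝ) ^ t) ^ (n + 1) := by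
        rw [inv_pow]; field_simp; ring
    _ ≤ f t / ((p : ℝ) ^ t) ^ (n + 1) := by gcongr; linarith

end Limits

section HilbertKunzLimit

open MvPowerSeries

variable {k : Type*} [Field k] {d : ℕ} {R : Type*} [CommRing R]
  [Algebra (MvPowerSeries (Fin d) k) R]

theorem pow_mul_pow_mem_map_varPow {p : ℕ} [Fact p.Prime] [CharP R p] {a c : R}
    (h : a * c ∈ Ideal.span (Set.range fun i => algebraMap (MvPowerSeries (Fin d) k) R (X i)))
    (t : ℕ) : a ^ p ^ t * c ^ p ^ t ∈
      (varPow k d (p ^ t)).map (algebraMap (MvPowerSeries (Fin d) k) R) := by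
  obtain ⟨f, hf⟩ := Ideal.mem_span_range_iff_exists_fun.mp h
  rw [← mul_pow, ← hf, sum_pow_char_pow]
  refine Ideal.sum_mem _ fun i _ => ?_
  rw [mul_pow, ← map_pow]
  exact Ideal.mul_mem_left _ _ (Ideal.mem_map_of_mem _ (Ideal.subset_span ⟨i, rfl⟩))

theorem exists_tendsto_finrank_quotient_powSpan [Algebra k R]
    [IsScalarTower k (MvPowerSeries (Fin d) k) R] {ι : Type*} [Fintype ι] [Nonempty ι] (p : ℕ)
    [Fact p.Prime] [CharP k p] (hd : d ≠ 0) (b : Module.Basis ι (MvPowerSeries (Fin d) k) R)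
    {S : Set R} (hS : ∀ i, algebraMap (MvPowerSeries (Fin d) k) R (X i) ∈ S)
    (hSS : ∀ a ∈ S, ∀ c ∈ S, a * c ∈
      Ideal.span (Set.range fun i => algebraMap (MvPowerSeries (Fin d) k) R (X i))) :
    ∃ L : ℝ, Tendsto (fun t : ℕ => (Module.finrank k (R ⧸ powSpan S (p ^ t)) : ℝ) /
        ((p ^ t : ℕ) : ℝ) ^ d) atTop (𝓝 L) ∧ (Fintype.card ι : ℝ) / 2 ≤ L := by
  have hp : p.Prime := Fact.out
  have : Module.Free (MvPowerSeries (Fin d) k) R := Module.Free.of_basis b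
  have : Module.Finite (MvPowerSeries (Fin d) k) R := Module.Finite.of_basis b
  have : Nontrivial R := ⟨b (Classical.arbitrary ι), 0, b.ne_zero _⟩
  have : IsDomain (MvPowerSeries (Fin d) k) := NoZeroDivisors.to_isDomain _
  have : CharP (MvPowerSeries (Fin d) k) p :=
    charP_of_injective_algebraMap (algebraMap k (MvPowerSeries (Fin d) k)).injective p
  have : CharP R p := charP_of_injective_algebraMap
    (FaithfulSMul.algebraMap_injective (MvPowerSeries (Fin d) k) R) p
  obtain ⟨s, ⟨ψ, hψ_smul, hψ_pow, δ, hδ0, hδ⟩, β, hβ, ε, hε0, hε⟩ :=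
    exists_integral_frobenius_and_form p (P := MvPowerSeries (Fin d) k) (R := R)
  obtain ⟨C, hC⟩ := exists_finrank_quotient_span_sup_varPow_le hδ0
  obtain ⟨C', hC'⟩ := exists_finrank_quotient_span_sup_varPow_le hε0
  have hpow : ∀ t, s ≤ t → ∀ a : R, ∃ c,
      a ^ p ^ t = c ^ p ^ s ∧ a ^ (p * p ^ t) = c ^ p ^ (s + 1) :=
    fun t ht a => ⟨a ^ p ^ (t - s), by rw [← pow_mul, ← pow_add, Nat.sub_add_cancel ht],
      by rw [← pow_mul, ← pow_add, ← pow_succ', ← add_assoc, Nat.sub_add_cancel ht]⟩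
  have hupper : ∀ t, s ≤ t → Module.finrank k (R ⧸ powSpan S (p ^ (t + 1))) ≤
      p ^ d * Module.finrank k (R ⧸ powSpan S (p ^ t)) +
        Fintype.card ι * C * (p ^ (t + 1)) ^ (d - 1) := fun t ht => by
    rw [pow_succ', mul_assoc]
    refine (finrank_quotient_powSpan_mul_le hp.ne_zero b hS hψ_smul (fun a r => ?_) hδ).trans
      (Nat.add_le_add_left (Nat.mul_le_mul_left _ (hC _)) _)
    obtain ⟨c, hc, hc'⟩ := hpow t ht a
    rw [hc, hc', hψ_pow]
  have hlower : ∀ t, s ≤ t → Fintype.card ι * (p ^ t) ^ d ≤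
      2 * Module.finrank k (R ⧸ powSpan S (p ^ t)) +
        Fintype.card ι * C' * (p ^ t) ^ (d - 1) := fun t ht => by
    rw [mul_assoc (Fintype.card ι) C']
    refine (card_mul_pow_le_finrank_quotient_powSpan (pow_ne_zero t hp.ne_zero) b hS
      (fun a r u => ?_) hε fun a ha c hc => pow_mul_pow_mem_map_varPow (hSS a ha c hc) t).trans
      (Nat.add_le_add_left (Nat.mul_le_mul_left _ (hC' _)) _)
    obtain ⟨c, hc, -⟩ := hpow t ht a
    rw [hc, hβ]
  obtain ⟨L, hL⟩ := exists_tendsto_div_pow_of_le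
    (f := fun t => Module.finrank k (R ⧸ powSpan S (p ^ t))) hp.one_lt hd hupper
  exact ⟨L, hL, half_le_of_tendsto_div_pow hp.one_lt hd hlower hL⟩

end HilbertKunzLimit

/-! ### Formal smoothness over perfect fields -/

section FormallySmooth

open MvPolynomial

theorem subsingleton_h1Cotangent_iff_mem_ker_sq {R S : Type*} [CommRing R] [CommRing S]
    [Algebra R S] : Subsingleton (Algebra.H1Cotangent R S) ↔ ∀ f : MvPolynomial S R,
      aeval (id : S → S) f = 0 → (∀ a, aeval (id : S → S) (pderiv a f) = 0) →
      f ∈ RingHom.ker (aeval (R := R) (id : S → S)) ^ 2 := by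
  let G := Algebra.Generators.self R S
  have cotangentComplex_eq_zero_iff (x : G.toExtension.ker) :
      G.toExtension.cotangentComplex (.mk x) = 0 ↔
        ∀ a, aeval (R := R) (id : S → S) (pderiv a x.1) = 0 := by
    rw [← G.cotangentSpaceBasis.repr.map_eq_zero_iff, Finsupp.ext_iff]
    refine forall_congr' fun a => ?_
    rw [Algebra.Extension.cotangentComplex_mk]
    erw [G.cotangentSpaceBasis_repr_one_tmul]
    rfl
  rw [Algebra.Extension.subsingleton_h1Cotangent, injective_iff_map_eq_zero]
  constructor
  · intro h f hf hd
    have hmk := h (.mk ⟨f, hf⟩) ((cotangentComplex_eq_zero_iff ⟨f, hf⟩).mpr hd)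
    rwa [Algebra.Extension.Cotangent.mk_eq_zero_iff] at hmk
  · intro h x hx
    obtain ⟨⟨f, hf⟩, rfl⟩ := Algebra.Extension.Cotangent.mk_surjective x
    rw [Algebra.Extension.Cotangent.mk_eq_zero_iff]
    exact h f hf ((cotangentComplex_eq_zero_iff ⟨f, hf⟩).mp hx)

/- The criterion above concerns one polynomial at a time, and a polynomial lives over the finitely
generated subextension generated by its variables, where formal smoothness is known. -/
theorem formallySmooth_of_perfectField (K L : Type*) [Field K] [PerfectField K]
    [Field L] [Algebra K L] : Algebra.FormallySmooth K L := by
  refine ⟨inferInstance, subsingleton_h1Cotangent_iff_mem_ker_sq.mpr fun f hf hd => ?_⟩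
  let E : IntermediateField K L := IntermediateField.adjoin K (f.vars : Set L)
  have : Algebra.EssFiniteType K E :=
    IntermediateField.essFiniteType_iff.mpr (IntermediateField.fg_adjoin_finset f.vars)
  have hinj : Function.Injective (algebraMap E L) := (algebraMap E L).injective
  obtain ⟨g, hgf⟩ := exists_rename_eq_of_vars_subset_range f (algebraMap E L) hinj fun a ha =>
    ⟨⟨a, IntermediateField.subset_adjoin K _ ha⟩, rfl⟩
  have aeval_rename_eq (h : MvPolynomial E K) : aeval (id : L → L) (rename (algebraMap E L) h) =
      algebraMap E L (aeval (id : E → E) h) := by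
    rw [aeval_rename, ← aeval_algebraMap_apply]
    rfl
  have hg : g ∈ RingHom.ker (aeval (R := K) (id : E → E)) ^ 2 :=
    subsingleton_h1Cotangent_iff_mem_ker_sq.mp Algebra.FormallySmooth.subsingleton_h1Cotangent g
      (hinj (by rw [map_zero, ← aeval_rename_eq, hgf, hf]))
      (fun a => hinj (by rw [map_zero, ← aeval_rename_eq, ← pderiv_rename hinj, hgf, hd]))
  have map_ker_le : (RingHom.ker (aeval (R := K) (id : E → E))).map
      (rename (R := K) (algebraMap E L)) ≤ RingHom.ker (aeval (R := K) (id : L → L)) := by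
    refine Ideal.map_le_iff_le_comap.mpr fun h hh => ?_
    rw [RingHom.mem_ker] at hh
    rw [Ideal.mem_comap, RingHom.mem_ker, aeval_rename_eq, hh, map_zero]
  rw [← hgf]
  refine Ideal.pow_right_mono map_ker_le 2 ?_
  rw [← Ideal.map_pow]
  exact Ideal.mem_map_of_mem _ hg

end FormallySmooth

/-! ### Cohen–Macaulay local rings -/

section CohenMacaulay

open IsLocalRing RingTheory.Sequence
open scoped Pointwise

theorem ringKrullDim_quotient_add_one_le_of_lt {A : Type*} [CommRing A] {Q Q' : Ideal A}
    [Q.IsPrime] (h : Q < Q') : ringKrullDim (A ⧸ Q') + 1 ≤ ringKrullDim (A ⧸ Q) := by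
  obtain ⟨y, hyQ', hyQ⟩ := SetLike.exists_of_lt h
  have hy : Ideal.Quotient.mk Q y ∈ nonZeroDivisors (A ⧸ Q) :=
    mem_nonZeroDivisors_of_ne_zero (by rwa [Ne, Ideal.Quotient.eq_zero_iff_mem])
  refine ringKrullDim_succ_le_of_surjective (Ideal.Quotient.factor h.le)
    (Ideal.Quotient.factor_surjective h.le) hy ?_
  rwa [Ideal.Quotient.factor_mk, Ideal.Quotient.eq_zero_iff_mem]

theorem exists_ne_zero_of_isAssociatedPrime {A M : Type*} [CommRing A] [IsNoetherianRing A]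
    [AddCommGroup M] [Module A M] {Q : Ideal A} (hQ : IsAssociatedPrime Q M) :
    ∃ z : M, z ≠ 0 ∧ ∀ a ∈ Q, a • z = 0 := by
  obtain ⟨hprime, z, rfl⟩ := isAssociatedPrime_iff.mp hQ
  refine ⟨z, ?_, fun a ha => by simpa [Submodule.mem_colon_singleton] using ha⟩
  rintro rfl
  exact hprime.ne_top Submodule.colon_singleton_zero

variable {A : Type u} [CommRing A] [IsLocalRing A] [IsNoetherianRing A]

theorem exists_ne_zero_quotSMulTop {M : Type*} [AddCommGroup M] [Module A M] [Module.Finite A M]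
    {Q : Ideal A} {y : A} (hy : y ∈ maximalIdeal A) (hreg : IsSMulRegular M y)
    (hQ : ∃ z : M, z ≠ 0 ∧ ∀ a ∈ Q, a • z = 0) :
    ∃ z : QuotSMulTop y M, z ≠ 0 ∧ ∀ a ∈ Q, a • z = 0 := by
  obtain ⟨z, hz0, hz⟩ := hQ
  let N : Submodule A M := Submodule.torsionBySet A M (Q : Set A)
  have mem_N (z) : z ∈ N ↔ ∀ a ∈ Q, a • z = 0 := by simp [N, Submodule.mem_torsionBySet_iff]
  have hN : ¬ N ≤ Ideal.span {y} • N := fun hle => by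
    refine hz0 ((Submodule.eq_bot_iff _).mp (Submodule.eq_bot_of_le_smul_of_le_jacobson_bot
      (Ideal.span {y}) N (IsNoetherian.noetherian N) hle ?_) z ((mem_N z).mpr hz))
    rwa [Ideal.span_singleton_le_iff_mem, jacobson_eq_maximalIdeal _ bot_ne_top]
  obtain ⟨z, hz, hzy⟩ := SetLike.not_le_iff_exists.mp hN
  refine ⟨Submodule.Quotient.mk z, fun h0 => hzy ?_, fun a ha => ?_⟩
  · obtain ⟨w, -, rfl⟩ := (Submodule.mem_smul_pointwise_iff_exists _ _ _).mp
      ((Submodule.Quotient.mk_eq_zero _).mp h0)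
    rw [Submodule.ideal_span_singleton_smul]
    refine Submodule.smul_mem_pointwise_smul _ _ _ ((mem_N w).mpr fun a ha => ?_)
    apply isSMulRegular_iff_right_eq_zero_of_smul.mp hreg
    rw [smul_comm, (mem_N _).mp hz a ha]
  · rw [← Submodule.Quotient.mk_smul, (mem_N z).mp hz a ha, Submodule.Quotient.mk_zero]

theorem exists_isAssociatedPrime_quotSMulTop_gt {M : Type*} [AddCommGroup M] [Module A M]
    [Module.Finite A M] {Q : Ideal A} {y : A} (hy : y ∈ maximalIdeal A)
    (hreg : IsSMulRegular M y) (hQ : IsAssociatedPrime Q M) :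
    ∃ Q', IsAssociatedPrime Q' (QuotSMulTop y M) ∧ Q < Q' := by
  have hQ0 := exists_ne_zero_of_isAssociatedPrime hQ
  obtain ⟨z, hz0, hz⟩ := exists_ne_zero_quotSMulTop hy hreg hQ0
  obtain ⟨Q', hQ', hle⟩ := exists_le_isAssociatedPrime_of_isNoetherianRing A z hz0
  have mem_of_smul_eq_zero {a : A} (ha : a • z = 0) : a ∈ Q' :=
    hle (Submodule.mem_colon_singleton.mpr ha)
  refine ⟨Q', hQ', SetLike.lt_iff_le_and_exists.mpr
    ⟨fun a ha => mem_of_smul_eq_zero (hz a ha), y, ?_, fun hyQ => ?_⟩⟩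
  · exact mem_of_smul_eq_zero (Module.mem_annihilator.mp (QuotSMulTop.mem_annihilator M y) z)
  · obtain ⟨w, hw0, hw⟩ := hQ0
    exact hw0 (isSMulRegular_iff_right_eq_zero_of_smul.mp hreg w (hw y hyQ))

theorem length_le_ringKrullDim_quotient (rs : List A) (hrs : ∀ r ∈ rs, r ∈ maximalIdeal A)
    {M : Type*} [AddCommGroup M] [Module A M] [Module.Finite A M] (hreg : IsRegular M rs)
    {Q : Ideal A} (hQ : IsAssociatedPrime Q M) :
    (rs.length : WithBot ℕ∞) ≤ ringKrullDim (A ⧸ Q) := by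
  have := hQ.isPrime
  induction rs generalizing M Q with
  | nil => simpa using ringKrullDim_nonneg_of_nontrivial
  | cons y rs ih =>
    rw [isRegular_cons_iff] at hreg
    obtain ⟨Q', hQ', hlt⟩ :=
      exists_isAssociatedPrime_quotSMulTop_gt (hrs y List.mem_cons_self) hreg.1 hQ
    rw [List.length_cons, Nat.cast_add, Nat.cast_one]
    exact (add_le_add_left (ih (fun r hr => hrs r (List.mem_cons_of_mem y hr)) hreg.2 hQ'
      hQ'.isPrime) 1).trans (ringKrullDim_quotient_add_one_le_of_lt hlt)

/- The Ext groups of the residue field detect the depth, and their long exact sequence shows that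
dividing by a regular element lowers the depth by at most one. -/
theorem exists_isRegular_quotSMulTop {M : Type u} [AddCommGroup M] [Module A M]
    [Module.Finite A M] [Nontrivial M] {x : A} (hx : x ∈ maximalIdeal A) (hreg : IsSMulRegular M x)
    (n : ℕ) (h : ∃ rs : List A, rs.length = n + 1 ∧ (∀ r ∈ rs, r ∈ maximalIdeal A) ∧
      IsRegular M rs) :
    ∃ rs : List A, rs.length = n ∧ (∀ r ∈ rs, r ∈ maximalIdeal A) ∧
      IsRegular (QuotSMulTop x M) rs := by
  obtain ⟨rs, hlen, hmem, hrs⟩ := h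
  let N : ModuleCat.{u} A := ModuleCat.of A (A ⧸ maximalIdeal A)
  have hsupp : Module.support A N = PrimeSpectrum.zeroLocus (maximalIdeal A : Set A) := by
    rw [Module.support_eq_zeroLocus, Ideal.annihilator_quotient]
  have smul_top_lt (L : Type u) [AddCommGroup L] [Module A L] [Module.Finite A L] [Nontrivial L] :
      maximalIdeal A • (⊤ : Submodule A L) < ⊤ :=
    (Submodule.top_ne_ideal_smul_of_le_jacobson_annihilator
      (maximalIdeal_le_jacobson _)).symm.lt_top
  have hext := ModuleCat.subsingleton_ext_of_exists_isRegular (maximalIdeal A) N hsupp.subset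
    (ModuleCat.of A M) (smul_top_lt M) rs hmem hrs
  have : Nontrivial (QuotSMulTop x M) := nontrivial_quotSMulTop_of_mem_maximalIdeal _ hx
  refine ModuleCat.exists_isRegular_of_exists_subsingleton_ext (maximalIdeal A) n
    (ModuleCat.of A (QuotSMulTop x M)) (smul_top_lt _) N hsupp fun i hi => ?_
  have zero_left := AddCommGrpCat.isZero_of_iff_subsingleton.mpr (hext i (by omega))
  have zero_right := AddCommGrpCat.isZero_of_iff_subsingleton.mpr (hext (i + 1) (by omega))
  exact AddCommGrpCat.subsingleton_of_isZero <|
    CategoryTheory.ShortComplex.Exact.isZero_of_both_zeros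
      ((CategoryTheory.Abelian.Ext.covariant_sequence_exact₃' N
        (IsSMulRegular.smulShortComplex_shortExact (M := ModuleCat.of A M) hreg)) i (i + 1) rfl)
      (zero_left.eq_zero_of_src _) (zero_right.eq_zero_of_tgt _)

theorem ringKrullDim_quotient_le_length {Q : Ideal A} [Q.IsPrime] {xs : List A}
    (hxs : ∀ x ∈ xs, x ∈ maximalIdeal A)
    (h : maximalIdeal A ≤ (Q ⊔ Ideal.ofList xs).radical) :
    ringKrullDim (A ⧸ Q) ≤ xs.length := by
  classical
  have : IsLocalRing (A ⧸ Q) := .of_surjective' (Ideal.Quotient.mk Q) Ideal.Quotient.mk_surjective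
  let T : Finset (A ⧸ Q) := (xs.map (Ideal.Quotient.mk Q)).toFinset
  have hT : Ideal.span (T : Set (A ⧸ Q)) = (Ideal.ofList xs).map (Ideal.Quotient.mk Q) := by
    simp [T, Ideal.map_ofList, Ideal.ofList]
  have map_maximalIdeal : (maximalIdeal A).map (Ideal.Quotient.mk Q) = maximalIdeal (A ⧸ Q) := by
    rw [← eq_maximalIdeal (Ideal.comap_isMaximal_of_surjective (K := maximalIdeal (A ⧸ Q)) _
      Ideal.Quotient.mk_surjective),
      Ideal.map_comap_of_surjective _ Ideal.Quotient.mk_surjective]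
  have hmin : maximalIdeal (A ⧸ Q) ∈ (Ideal.span (T : Set (A ⧸ Q))).minimalPrimes := by
    rw [hT]
    refine ⟨⟨inferInstance, ?_⟩, fun P ⟨hP, hTP⟩ _ => ?_⟩
    · rw [← map_maximalIdeal]
      exact Ideal.map_mono (Ideal.span_le.mpr hxs)
    · rw [← map_maximalIdeal, Ideal.map_le_iff_le_comap]
      refine h.trans ((Ideal.IsPrime.radical_le_iff inferInstance).mpr
        (sup_le (fun a ha => ?_) (Ideal.map_le_iff_le_comap.mp hTP)))
      rw [Ideal.mem_comap, Ideal.Quotient.eq_zero_iff_mem.mpr ha]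
      exact zero_mem P
  have hheight : (maximalIdeal (A ⧸ Q)).height ≤ (xs.length : ℕ∞) :=
    (Ideal.height_le_card_of_mem_minimalPrimes_span_finset hmin).trans
      (by exact_mod_cast (List.toFinset_card_le _).trans_eq (List.length_map _))
  rw [← maximalIdeal_height_eq_ringKrullDim]
  exact_mod_cast hheight

theorem isSMulRegular_of_parameters {x : A} {xs : List A} (hxs : ∀ y ∈ xs, y ∈ maximalIdeal A)
    {M : Type*} [AddCommGroup M] [Module A M] [Module.Finite A M]
    (h : maximalIdeal A ≤ (Module.annihilator A M ⊔ Ideal.ofList (x :: xs)).radical)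
    {rs : List A} (hlen : rs.length = xs.length + 1) (hmem : ∀ r ∈ rs, r ∈ maximalIdeal A)
    (hrs : IsRegular M rs) : IsSMulRegular M x := by
  by_contra hx
  obtain ⟨Q, hQ, hxQ⟩ : ∃ Q ∈ associatedPrimes A M, x ∈ Q := by
    have hx' : x ∈ ⋃ p ∈ associatedPrimes A M, (p : Set A) := by
      rw [biUnion_associatedPrimes_eq_compl_regular]
      exact hx
    simpa using hx'
  have := hQ.isPrime
  have hann : Module.annihilator A M ≤ Q :=
    (Submodule.annihilator_top (R := A) (M := M)).symm.le.trans hQ.annihilator_le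
  have hle : Module.annihilator A M ⊔ Ideal.ofList (x :: xs) ≤ Q ⊔ Ideal.ofList xs := by
    rw [Ideal.ofList_cons]
    exact sup_le (le_sup_of_le_left hann)
      (sup_le_sup_right ((Ideal.span_singleton_le_iff_mem Q).mpr hxQ) _)
  have hdim := (length_le_ringKrullDim_quotient rs hmem hrs hQ).trans
    (ringKrullDim_quotient_le_length hxs (h.trans (Ideal.radical_mono hle)))
  have : rs.length ≤ xs.length := by exact_mod_cast hdim
  omega

theorem isWeaklyRegular_of_parameters (xs : List A) (hxs : ∀ x ∈ xs, x ∈ maximalIdeal A)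
    {M : Type u} [AddCommGroup M] [Module A M] [Module.Finite A M]
    (h : maximalIdeal A ≤ (Module.annihilator A M ⊔ Ideal.ofList xs).radical)
    (hdepth : ∃ rs : List A, rs.length = xs.length ∧ (∀ r ∈ rs, r ∈ maximalIdeal A) ∧
      IsRegular M rs) : IsWeaklyRegular M xs := by
  induction xs generalizing M with
  | nil => exact IsWeaklyRegular.nil A M
  | cons x xs ih =>
    have hxs' : ∀ y ∈ xs, y ∈ maximalIdeal A := fun y hy => hxs y (List.mem_cons_of_mem x hy)
    obtain ⟨rs, hlen, hmem, hrs⟩ := hdepth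
    have : Nontrivial M := hrs.nontrivial
    have hx : IsSMulRegular M x := isSMulRegular_of_parameters hxs' h hlen hmem hrs
    refine IsWeaklyRegular.cons hx (ih hxs' (h.trans (Ideal.radical_mono ?_))
      (exists_isRegular_quotSMulTop (hxs x List.mem_cons_self) hx _ ⟨rs, hlen, hmem, hrs⟩))
    rw [Ideal.ofList_cons, ← sup_assoc]
    refine sup_le_sup_right (sup_le ?_ ?_) _
    · exact LinearMap.annihilator_le_of_surjective (Submodule.mkQ _) (Submodule.mkQ_surjective _)
    · exact (Ideal.span_singleton_le_iff_mem _).mpr (QuotSMulTop.mem_annihilator M x)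

theorem IsCohenMacaulayLocal.mem_span_of_mul_mem (hCM : IsCohenMacaulayLocal A)
    {ι : Type*} [Fintype ι] (hdim : ringKrullDim A = (Fintype.card ι : WithBot ℕ∞)) {w : ι → A}
    (hw : ∀ i, w i ∈ maximalIdeal A)
    (h : maximalIdeal A ≤ (Ideal.span (Set.range w)).radical) (i : ι) {a : A}
    (ha : w i * a ∈ Ideal.span (w '' {i}ᶜ)) : a ∈ Ideal.span (w '' {i}ᶜ) := by
  classical
  let l : List A := (Finset.univ.erase i).toList.map w
  have hl : Ideal.ofList l = Ideal.span (w '' {i}ᶜ) :=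
    congrArg Ideal.span (by ext a; simp [l])
  have hli : Ideal.ofList (l ++ [w i]) = Ideal.span (Set.range w) := by
    rw [Ideal.ofList_append, hl, Ideal.ofList_singleton, ← Ideal.span_union, Set.union_comm,
      ← Set.image_singleton, ← Set.image_union, Set.union_compl_self, Set.image_univ]
  obtain ⟨rs, hrs, hreg, hlen⟩ := hCM
  have hlength : rs.length = (l ++ [w i]).length := by
    have hcard : rs.length = Fintype.card ι := by exact_mod_cast hlen.symm.trans hdim
    have := Fintype.card_pos_iff.mpr ⟨i⟩
    simp only [hcard, l, List.length_append, List.length_map, Finset.length_toList,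
      Finset.card_erase_of_mem (Finset.mem_univ i), Finset.card_univ, List.length_singleton]
    omega
  have hweak : IsWeaklyRegular A (l ++ [w i]) := by
    refine isWeaklyRegular_of_parameters (l ++ [w i]) ?_ (h.trans (Ideal.radical_mono ?_))
      ⟨rs, hlength, hrs, hreg⟩
    · intro x hx
      have hx' : x ∈ Ideal.span (Set.range w) := hli ▸ Ideal.subset_span hx
      exact Ideal.span_le.mpr (Set.range_subset_iff.mpr hw) hx'
    · exact hli ▸ le_sup_right
  have hreg_i := ((isWeaklyRegular_append_iff A l [w i]).mp hweak).2
  rw [isWeaklyRegular_singleton_iff, hl] at hreg_i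
  have hmk := isSMulRegular_iff_right_eq_zero_of_smul.mp hreg_i (Submodule.Quotient.mk a)
  rw [← Submodule.Quotient.mk_smul, Submodule.Quotient.mk_eq_zero, Submodule.Quotient.mk_eq_zero]
    at hmk
  simpa using hmk (by simpa using ha)

end CohenMacaulay

/-! ### Colengths of powers of parameters -/

section Colength

theorem length_quotient_sup_span_singleton {A : Type*} [CommRing A] (T : Ideal A) (c : A) :
    Module.length A (A ⧸ T ⊔ Ideal.span {c}) = Ring.ord (A ⧸ T) (Ideal.Quotient.mk T c) := by
  rw [Ring.ord, ← Module.length_eq_of_surjective (S := A) Ideal.Quotient.mk_surjective,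
    ← Set.image_singleton, ← Ideal.map_span]
  exact (DoubleQuot.quotQuotEquivQuotSupₐ A T (Ideal.span {c})).toLinearEquiv.length_eq.symm

theorem length_quotient_sup_span_pow {A : Type*} [CommRing A] (T : Ideal A) (c : A)
    (h : ∀ a, c * a ∈ T → a ∈ T) (n : ℕ) :
    Module.length A (A ⧸ T ⊔ Ideal.span {c ^ n}) =
      n * Module.length A (A ⧸ T ⊔ Ideal.span {c}) := by
  have hc : Ideal.Quotient.mk T c ∈ nonZeroDivisors (A ⧸ T) := by
    refine mem_nonZeroDivisors_iff_right.mpr fun z hz => ?_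
    obtain ⟨a, rfl⟩ := Ideal.Quotient.mk_surjective z
    rw [← map_mul, Ideal.Quotient.eq_zero_iff_mem, mul_comm] at hz
    exact Ideal.Quotient.eq_zero_iff_mem.mpr (h a hz)
  rw [length_quotient_sup_span_singleton, length_quotient_sup_span_singleton, map_pow,
    Ring.ord_pow hc, nsmul_eq_mul]

open IsLocalRing

variable {A : Type u} [CommRing A] [IsLocalRing A] [IsNoetherianRing A]

theorem IsCohenMacaulayLocal.length_quotient_span_range_update (hCM : IsCohenMacaulayLocal A)
    {ι : Type*} [Fintype ι] [DecidableEq ι] (hdim : ringKrullDim A = (Fintype.card ι : WithBot ℕ∞))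
    {w : ι → A} (hw : ∀ i, w i ∈ maximalIdeal A)
    (h : maximalIdeal A ≤ (Ideal.span (Set.range w)).radical) (i : ι) (n : ℕ) :
    Module.length A (A ⧸ Ideal.span (Set.range (Function.update w i (w i ^ n)))) =
      n * Module.length A (A ⧸ Ideal.span (Set.range w)) := by
  have span_range_eq_sup (v : ι → A) : Ideal.span (Set.range v) =
      Ideal.span (v '' {i}ᶜ) ⊔ Ideal.span {v i} := by
    rw [← Set.image_univ, ← Set.compl_union_self {i}, Set.image_union, Ideal.span_union,
      Set.image_singleton]
  have hupdate : Function.update w i (w i ^ n) '' {i}ᶜ = w '' {i}ᶜ :=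
    Set.image_congr fun j hj => Function.update_of_ne hj _ _
  rw [span_range_eq_sup, hupdate, Function.update_self,
    length_quotient_sup_span_pow _ _ (fun _ => hCM.mem_span_of_mul_mem hdim hw h i),
    ← span_range_eq_sup]

theorem IsCohenMacaulayLocal.length_quotient_span_range_pow (hCM : IsCohenMacaulayLocal A)
    {ι : Type*} [Fintype ι] (hdim : ringKrullDim A = (Fintype.card ι : WithBot ℕ∞)) {x : ι → A}
    (hx : ∀ i, x i ∈ maximalIdeal A)
    (h : maximalIdeal A ≤ (Ideal.span (Set.range x)).radical) {n : ι → ℕ} (hn : ∀ i, n i ≠ 0) :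
    Module.length A (A ⧸ Ideal.span (Set.range fun i => x i ^ n i)) =
      (∏ i, n i : ℕ) * Module.length A (A ⧸ Ideal.span (Set.range x)) := by
  classical
  let w (s : Finset ι) : ι → A := s.piecewise (fun i => x i ^ n i) x
  have w_mem (s : Finset ι) (i : ι) : w s i ∈ maximalIdeal A :=
    s.piecewise_cases (i := i) _ x (· ∈ maximalIdeal A)
      (Ideal.pow_mem_of_mem _ (hx i) _ (Nat.pos_of_ne_zero (hn i))) (hx i)
  have le_radical (s : Finset ι) : maximalIdeal A ≤ (Ideal.span (Set.range (w s))).radical := by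
    refine h.trans (Ideal.radical_le_radical_iff.mpr (Ideal.span_le.mpr ?_))
    rintro _ ⟨i, rfl⟩
    have hi : w s i ∈ Ideal.span (Set.range (w s)) := Ideal.subset_span ⟨i, rfl⟩
    by_cases his : i ∈ s
    · exact ⟨n i, by simpa [w, his] using hi⟩
    · exact ⟨1, by simpa [w, his] using hi⟩
  have hlength (s : Finset ι) : Module.length A (A ⧸ Ideal.span (Set.range (w s))) =
      (∏ i ∈ s, n i : ℕ) * Module.length A (A ⧸ Ideal.span (Set.range x)) := by
    induction s using Finset.induction_on with
    | empty =>
      rw [show w ∅ = x from Finset.piecewise_empty _ _, Finset.prod_empty, Nat.cast_one, one_mul]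
    | insert i s hi ih =>
      have hwi : w s i = x i := s.piecewise_eq_of_notMem _ _ hi
      have hinsert : w (insert i s) = Function.update (w s) i (w s i ^ n i) := by
        rw [hwi, ← s.piecewise_insert]
      rw [hinsert, hCM.length_quotient_span_range_update hdim (w_mem s) (le_radical s), ih,
        Finset.prod_insert hi, Nat.cast_mul, mul_assoc]
  rw [← hlength, show w Finset.univ = fun i => x i ^ n i from Finset.piecewise_univ _ _]

end Colength

/-! ### Freeness over power series rings -/

section PowerSeriesHom

open MvPowerSeries

theorem exists_ringHom_mvPowerSeries {k R : Type*} [CommRing k] [CommRing R] (K : Ideal R)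
    [IsAdicComplete K R] {ι : Type*} [Finite ι] (σ : k →+* R) (x : ι → R) (hx : ∀ i, x i ∈ K) :
    ∃ φ : MvPowerSeries ι k →+* R, (∀ c, φ (C c) = σ c) ∧ ∀ i, φ (X i) = x i := by
  let : WithIdeal R := ⟨K⟩
  have hK : IsAdic K := rfl
  obtain ⟨_, _⟩ := hK.isAdicComplete_iff.mp inferInstance
  let : UniformSpace k := ⊥
  have : DiscreteTopology k := ⟨rfl⟩
  have hσ : Continuous σ := continuous_of_discreteTopology
  have hx_eval : HasEval x :=
    ⟨fun i => WithIdeal.isTopologicallyNilpotent_of_mem (hx i), by simp⟩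
  refine ⟨eval₂Hom hσ hx_eval, fun c => ?_, fun i => ?_⟩
  · rw [coe_eval₂Hom, eval₂_C]
  · rw [coe_eval₂Hom, eval₂_X]

end PowerSeriesHom

section Freeness

variable {P ι : Type*} [CommRing P]

theorem mem_smul_top_pi_iff [Finite ι] (I : Ideal P) (f : ι → P) :
    f ∈ (I • ⊤ : Submodule P (ι → P)) ↔ ∀ i, f i ∈ I := by
  rw [Ideal.smul_top_eq_map, Submodule.restrictScalars_mem,
    mem_map_algebraMap_iff_repr_mem (Pi.basisFun P ι)]
  simp only [Pi.basisFun_repr]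

theorem isPrecomplete_pi [Finite ι] (I : Ideal P) [IsPrecomplete I P] :
    IsPrecomplete I (ι → P) := by
  refine ⟨fun f hf => ?_⟩
  have exists_limit (i : ι) : ∃ L : P, ∀ n, f n i ≡ L [SMOD (I ^ n • ⊤ : Submodule P P)] := by
    refine IsPrecomplete.prec' _ fun {m n} hmn => ?_
    have hmod := hf hmn
    rw [SModEq.sub_mem, mem_smul_top_pi_iff] at hmod
    simpa [SModEq.sub_mem] using hmod i
  choose L hL using exists_limit
  refine ⟨L, fun n => ?_⟩
  rw [SModEq.sub_mem, mem_smul_top_pi_iff]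
  simpa [SModEq.sub_mem] using fun i => hL i n

variable {k R : Type*} [Field k] [CommRing R] [Algebra k P] [Algebra P R] [Algebra k R]
  [IsScalarTower k P R]

theorem linearCombination_surjective_of_span_quotient_eq_top [Fintype ι] (K : Ideal P)
    [IsPrecomplete K P] [IsHausdorff K R] {v : ι → R}
    (hv : Submodule.span k (Set.range fun i =>
      Ideal.Quotient.mk (K.map (algebraMap P R)) (v i)) = ⊤) :
    Function.Surjective (Fintype.linearCombination P v) := by
  have := isPrecomplete_pi (ι := ι) K
  refine surjective_of_mkQ_comp_surjective (I := K) fun z => ?_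
  obtain ⟨r, rfl⟩ := Submodule.Quotient.mk_surjective _ z
  obtain ⟨c, hc⟩ := (Submodule.mem_span_range_iff_exists_fun k).mp
    (hv.ge (Submodule.mem_top (x := Ideal.Quotient.mk _ r)))
  refine ⟨fun i => algebraMap k P (c i), ?_⟩
  rw [LinearMap.comp_apply, Submodule.mkQ_apply, Submodule.Quotient.eq, Ideal.smul_top_eq_map,
    Submodule.restrictScalars_mem, ← Ideal.Quotient.eq, ← hc, Fintype.linearCombination_apply,
    map_sum]
  refine Finset.sum_congr rfl fun i _ => ?_
  rw [algebraMap_smul, ← Ideal.Quotient.mkₐ_eq_mk k, map_smul]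

theorem ker_le_of_surjective_of_finrank_quotient_eq {M N : Type*} [AddCommGroup M] [Module k M]
    [AddCommGroup N] [Module k N] {f : M →ₗ[k] N} (hf : Function.Surjective f)
    {U : Submodule k M} {W : Submodule k N} [FiniteDimensional k (M ⧸ U)]
    [FiniteDimensional k (N ⧸ W)] (hUW : U ≤ W.comap f)
    (hfinrank : Module.finrank k (M ⧸ U) = Module.finrank k (N ⧸ W)) : LinearMap.ker f ≤ U := by
  have hsurj : Function.Surjective (U.mapQ W f hUW) := fun z => by
    obtain ⟨y, rfl⟩ := W.mkQ_surjective z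
    obtain ⟨x, rfl⟩ := hf y
    exact ⟨U.mkQ x, rfl⟩
  have hinj := (LinearMap.injective_iff_surjective_of_finrank_eq_finrank hfinrank).mpr hsurj
  intro x hx
  rw [LinearMap.mem_ker] at hx
  refine (Submodule.Quotient.mk_eq_zero U).mp (hinj ?_)
  rw [Submodule.mapQ_apply, hx, Submodule.Quotient.mk_zero, map_zero]

theorem mem_of_linearCombination_eq_zero [Fintype ι] {v : ι → R}
    (hv : Function.Surjective (Fintype.linearCombination P v)) {V : Ideal P}
    [FiniteDimensional k (P ⧸ V)] [FiniteDimensional k (R ⧸ V.map (algebraMap P R))]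
    (hfinrank : Module.finrank k (R ⧸ V.map (algebraMap P R)) =
      Fintype.card ι * Module.finrank k (P ⧸ V)) {g : ι → P}
    (hg : Fintype.linearCombination P v g = 0) (i : ι) : g i ∈ V := by
  let b := Pi.basisFun P ι
  have : FiniteDimensional k
      ((ι → P) ⧸ (V.map (algebraMap P (ι → P))).restrictScalars k) :=
    finiteDimensional_quotient_map b V
  have : FiniteDimensional k (R ⧸ (V.map (algebraMap P R)).restrictScalars k) :=
    inferInstanceAs (FiniteDimensional k (R ⧸ V.map (algebraMap P R)))
  have hle : ((V.map (algebraMap P (ι → P))).restrictScalars P) ≤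
      ((V.map (algebraMap P R)).restrictScalars P).comap (Fintype.linearCombination P v) := by
    rw [← Ideal.smul_top_eq_map, ← Ideal.smul_top_eq_map, ← Submodule.map_le_iff_le_comap,
      Submodule.map_smul'']
    exact Submodule.smul_mono le_rfl le_top
  have hker := ker_le_of_surjective_of_finrank_quotient_eq (k := k)
    (f := (Fintype.linearCombination P v).restrictScalars k) hv
    (U := (V.map (algebraMap P (ι → P))).restrictScalars k)
    (W := (V.map (algebraMap P R)).restrictScalars k) hle
    ((finrank_quotient_map b V).trans hfinrank.symm) hg
  rw [Submodule.restrictScalars_mem, mem_map_algebraMap_iff_repr_mem b] at hker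
  exact hker i

end Freeness

section PowerSeriesFreeness

open MvPowerSeries

variable {k R : Type*} [Field k] {d : ℕ} [CommRing R] [Algebra (MvPowerSeries (Fin d) k) R]
  [Algebra k R] [IsScalarTower k (MvPowerSeries (Fin d) k) R]

theorem exists_basis_of_finrank_quotient_varPow
    [IsHausdorff (Ideal.span (Set.range X) : Ideal (MvPowerSeries (Fin d) k)) R] {e : ℕ}
    (he0 : e ≠ 0) (he : ∀ q, q ≠ 0 → Module.finrank k (R ⧸ (varPow k d q).map
      (algebraMap (MvPowerSeries (Fin d) k) R)) = e * q ^ d) :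
    Nonempty (Module.Basis (Fin e) (MvPowerSeries (Fin d) k) R) := by
  let 𝔛 : Ideal (MvPowerSeries (Fin d) k) := Ideal.span (Set.range X)
  have hfinrank : Module.finrank k (R ⧸ 𝔛.map (algebraMap _ R)) = e := by
    rw [show 𝔛 = varPow k d 1 by simp [varPow, 𝔛], he 1 one_ne_zero, one_pow, mul_one]
  have hfinite (q : ℕ) (hq : q ≠ 0) : FiniteDimensional k (R ⧸ (varPow k d q).map
      (algebraMap (MvPowerSeries (Fin d) k) R)) :=
    .of_finrank_pos (by rw [he q hq]; positivity)
  have : FiniteDimensional k (R ⧸ 𝔛.map (algebraMap _ R)) := .of_finrank_pos (by omega)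
  let b := Module.finBasisOfFinrankEq k _ hfinrank
  choose v hv using fun i => Ideal.Quotient.mk_surjective (b i)
  have hsurj : Function.Surjective (Fintype.linearCombination (MvPowerSeries (Fin d) k) v) :=
    linearCombination_surjective_of_span_quotient_eq_top (k := k) 𝔛 (by
      simp only [hv]; exact b.span_eq)
  refine ⟨.ofEquivFun (LinearEquiv.ofBijective _ ⟨?_, hsurj⟩).symm⟩
  rw [injective_iff_map_eq_zero]
  refine fun g hg => funext fun i => eq_zero_of_forall_mem_varPow fun q hq => ?_
  have := hfinite q hq
  refine mem_of_linearCombination_eq_zero (k := k) hsurj ?_ hg i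
  rw [he q hq, finrank_quotient_varPow, Fintype.card_fin]

end PowerSeriesFreeness

/-! ### Lengths and the completion -/

section FiniteLength

open IsLocalRing

theorem length_eq_length_of_isFiniteLength {k R M : Type*} [Field k] [CommRing R] [IsLocalRing R]
    [AddCommGroup M] [Module R M] (hM : IsFiniteLength R M) [Algebra k R]
    (hk : ∀ r : R, ∃ c : k, r - algebraMap k R c ∈ maximalIdeal R) :
    ∀ [Module k M] [IsScalarTower k R M], Module.length k M = Module.length R M := by
  induction hM with
  | of_subsingleton =>
    intro _ _
    rw [Module.length_eq_zero, Module.length_eq_zero]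
  | @of_simple_quotient M _ _ N hN _ ih =>
    intro _ _
    have hlengthR := Module.length_eq_add_of_exact N.subtype N.mkQ N.injective_subtype
      N.mkQ_surjective (LinearMap.exact_subtype_mkQ N)
    have hlengthk := Module.length_eq_add_of_exact (N.subtype.restrictScalars k)
      (N.mkQ.restrictScalars k) N.injective_subtype N.mkQ_surjective
      (LinearMap.exact_subtype_mkQ N)
    rw [hlengthR, hlengthk, ih]
    congr 1
    obtain ⟨I, hI, ⟨f⟩⟩ := isSimpleModule_iff_quot_maximal.mp hN
    obtain rfl := eq_maximalIdeal hI
    rw [f.length_eq, (f.restrictScalars k).length_eq]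
    have hsurj : Function.Surjective (algebraMap k (R ⧸ maximalIdeal R)) := fun z => by
      obtain ⟨r, rfl⟩ := Ideal.Quotient.mk_surjective z
      obtain ⟨c, hc⟩ := hk r
      exact ⟨c, (Ideal.Quotient.eq.mpr hc).symm⟩
    rw [Module.length_eq_of_surjective hsurj,
      Module.length_eq_of_surjective (S := R) (R := R ⧸ maximalIdeal R)
        Ideal.Quotient.mk_surjective]

variable {A : Type*} [CommRing A] [IsLocalRing A] [IsNoetherianRing A]

theorem exists_maximalIdeal_pow_le_of_pow_mem {s : Set A} {N : ℕ}
    (hN : maximalIdeal A ^ N ≤ Ideal.span s) {K : Ideal A} {q : ℕ} (h : ∀ a ∈ s, a ^ q ∈ K) :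
    ∃ N', maximalIdeal A ^ N' ≤ K := by
  have hradical : maximalIdeal A ^ N ≤ K.radical :=
    hN.trans (Ideal.span_le.mpr fun a ha => ⟨q, h a ha⟩)
  obtain ⟨n, hn⟩ := Ideal.exists_pow_le_of_le_radical_of_fg hradical (IsNoetherian.noetherian _)
  exact ⟨N * n, by rwa [pow_mul]⟩

theorem isFiniteLength_quotient_of_maximalIdeal_pow_le {I : Ideal A} {N : ℕ}
    (hI : maximalIdeal A ^ N ≤ I) : IsFiniteLength A (A ⧸ I) := by
  by_cases htop : I = ⊤
  · have : Subsingleton (A ⧸ I) := Ideal.Quotient.subsingleton_iff.mpr htop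
    exact .of_subsingleton
  have : Nontrivial (A ⧸ I) := Ideal.Quotient.nontrivial_iff.mpr htop
  have : IsLocalRing (A ⧸ I) := .of_surjective' (Ideal.Quotient.mk I) Ideal.Quotient.mk_surjective
  have hmap : maximalIdeal (A ⧸ I) = (maximalIdeal A).map (Ideal.Quotient.mk I) := by
    rw [← eq_maximalIdeal (Ideal.comap_isMaximal_of_surjective (Ideal.Quotient.mk I)
      Ideal.Quotient.mk_surjective (K := maximalIdeal (A ⧸ I))),
      Ideal.map_comap_of_surjective _ Ideal.Quotient.mk_surjective]
  have hnilpotent : IsNilpotent (maximalIdeal (A ⧸ I)) := by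
    refine ⟨N, ?_⟩
    rwa [hmap, ← Ideal.map_pow, Ideal.zero_eq_bot, Ideal.map_eq_bot_iff_le_ker, Ideal.mk_ker]
  have : IsArtinianRing (A ⧸ I) := isArtinianRing_iff_isNilpotent_maximalIdeal _ |>.mpr hnilpotent
  rw [← Module.length_ne_top_iff,
    Module.length_eq_of_surjective (R := A ⧸ I) Ideal.Quotient.mk_surjective]
  exact Module.length_ne_top

theorem toNat_length_quotient_ne_zero {I : Ideal A} {N : ℕ} (hI : maximalIdeal A ^ N ≤ I)
    (hI' : I ≤ maximalIdeal A) : (Module.length A (A ⧸ I)).toNat ≠ 0 := by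
  intro h0
  rw [ENat.toNat_eq_zero, or_iff_left (Module.length_ne_top_iff.mpr
      (isFiniteLength_quotient_of_maximalIdeal_pow_le hI)),
    Module.length_eq_zero_iff, Ideal.Quotient.subsingleton_iff] at h0
  exact (maximalIdeal.isMaximal A).ne_top (top_le_iff.mp (h0 ▸ hI'))

end FiniteLength

section Completion

open IsLocalRing AdicCompletion

/-- The completion of a local ring in the topology defined by its maximal ideal. -/
abbrev MaxAdicCompletion (A : Type*) [CommRing A] [IsLocalRing A] : Type _ :=
  AdicCompletion (maximalIdeal A) A

theorem algebraMap_mem_map_maxAdicCompletion_iff {A : Type*} [CommRing A] [IsLocalRing A]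
    {I : Ideal A} {N : ℕ} (hI : maximalIdeal A ^ N ≤ I) (a : A) :
    algebraMap A (MaxAdicCompletion A) a ∈ I.map (algebraMap A (MaxAdicCompletion A)) ↔ a ∈ I := by
  refine ⟨fun h => ?_, Ideal.mem_map_of_mem _⟩
  have hcomp : (evalₐ (maximalIdeal A) N).toRingHom.comp (algebraMap A (MaxAdicCompletion A)) =
      Ideal.Quotient.mk (maximalIdeal A ^ N) :=
    RingHom.ext (evalₐ (maximalIdeal A) N).commutes
  have heval := Ideal.mem_map_of_mem (evalₐ (maximalIdeal A) N).toRingHom h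
  rwa [Ideal.map_map, hcomp, ← RingHom.comp_apply, hcomp, Ideal.mem_quotient_iff_mem hI] at heval

variable {A : Type u} [CommRing A] [IsLocalRing A] [IsNoetherianRing A]

theorem exists_sub_algebraMap_mem_map_maximalIdeal_pow (N : ℕ) (r : MaxAdicCompletion A) :
    ∃ a : A, r - algebraMap A (MaxAdicCompletion A) a ∈
      (maximalIdeal A ^ N).map (algebraMap A (MaxAdicCompletion A)) := by
  obtain ⟨a, ha⟩ := Ideal.Quotient.mk_surjective (r.1 N)
  refine ⟨a, ?_⟩
  rw [← Submodule.restrictScalars_mem A, ← Ideal.smul_top_eq_map,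
    pow_smul_top_eq_ker_eval (maximalIdeal A).fg_of_isNoetherianRing, LinearMap.mem_ker, map_sub,
    sub_eq_zero, AdicCompletion.algebraMap_apply]
  exact ha.symm

theorem algebraMap_quotient_map_surjective {I : Ideal A} {N : ℕ} (hI : maximalIdeal A ^ N ≤ I) :
    Function.Surjective (algebraMap A
      (MaxAdicCompletion A ⧸ I.map (algebraMap A (MaxAdicCompletion A)))) := fun z => by
  obtain ⟨r, rfl⟩ := Ideal.Quotient.mk_surjective z
  obtain ⟨a, ha⟩ := exists_sub_algebraMap_mem_map_maximalIdeal_pow N r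
  exact ⟨a, (Ideal.Quotient.eq.mpr (Ideal.map_mono hI ha)).symm⟩

theorem length_quotient_map_maxAdicCompletion {I : Ideal A} {N : ℕ}
    (hI : maximalIdeal A ^ N ≤ I) :
    Module.length (MaxAdicCompletion A)
      (MaxAdicCompletion A ⧸ I.map (algebraMap A (MaxAdicCompletion A))) =
      Module.length A (A ⧸ I) := by
  let Q := MaxAdicCompletion A ⧸ I.map (algebraMap A (MaxAdicCompletion A))
  have hsurj : Function.Surjective (Algebra.linearMap A Q) := algebraMap_quotient_map_surjective hI
  have hker : LinearMap.ker (Algebra.linearMap A Q) = I := by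
    ext a
    rw [LinearMap.mem_ker, Algebra.linearMap_apply,
      IsScalarTower.algebraMap_apply A (MaxAdicCompletion A) Q, Ideal.Quotient.algebraMap_eq,
      Ideal.Quotient.eq_zero_iff_mem, algebraMap_mem_map_maxAdicCompletion_iff hI]
  rw [Module.length_eq_of_surjective (S := MaxAdicCompletion A) (R := Q)
    Ideal.Quotient.mk_surjective, ← Module.length_eq_of_surjective hsurj]
  exact ((Submodule.quotEquivOfEq _ _ hker.symm).trans
    ((Algebra.linearMap A Q).quotKerEquivOfSurjective hsurj)).length_eq.symm

theorem length_quotient_eq_finrank_quotient_map {k : Type*} [Field k]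
    [Algebra k (MaxAdicCompletion A)]
    (hk : ∀ r, ∃ c : k, r - algebraMap k (MaxAdicCompletion A) c ∈
      maximalIdeal (MaxAdicCompletion A)) {I : Ideal A} {N : ℕ} (hI : maximalIdeal A ^ N ≤ I) :
    Module.length A (A ⧸ I) =
      Module.finrank k (MaxAdicCompletion A ⧸ I.map (algebraMap A (MaxAdicCompletion A))) := by
  let Q := MaxAdicCompletion A ⧸ I.map (algebraMap A (MaxAdicCompletion A))
  have hlength : Module.length (MaxAdicCompletion A) Q = Module.length A (A ⧸ I) :=
    length_quotient_map_maxAdicCompletion hI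
  have hfin : IsFiniteLength (MaxAdicCompletion A) Q := by
    rw [← Module.length_ne_top_iff, hlength, Module.length_ne_top_iff]
    exact isFiniteLength_quotient_of_maximalIdeal_pow_le hI
  have hlength_k : Module.length k Q = Module.length (MaxAdicCompletion A) Q :=
    length_eq_length_of_isFiniteLength hfin hk
  have : IsNoetherian k Q := by
    refine (isFiniteLength_iff_isNoetherian_isArtinian.mp ?_).1
    rwa [← Module.length_ne_top_iff, hlength_k, Module.length_ne_top_iff]
  rw [← hlength, ← hlength_k, Module.length_eq_finrank]

-- The residue field is formally smooth over the prime field, so its identity map lifts to `Â`.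
theorem exists_ringHom_residueField_maxAdicCompletion (p : ℕ) [Fact p.Prime] [CharP A p] :
    ∃ σ : ResidueField A →+* MaxAdicCompletion A, ∀ r, ∃ c,
      r - σ c ∈ maximalIdeal (MaxAdicCompletion A) := by
  let : Algebra (ZMod p) A := ZMod.algebra A p
  let : Algebra (ZMod p) (ResidueField A) := inferInstance
  have := formallySmooth_of_perfectField (ZMod p) (ResidueField A)
  obtain ⟨σ, hσ⟩ := Algebra.FormallySmooth.exists_adicCompletionEvalOneₐ_comp_eq
    (AlgHom.id (ZMod p) (ResidueField A) : ResidueField A →ₐ[ZMod p] A ⧸ maximalIdeal A)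
  refine ⟨σ.toRingHom, fun r => ⟨evalOneₐ (maximalIdeal A) r, ?_⟩⟩
  rw [maximalIdeal_eq_map, ← ker_evalOneₐ_eq_map _ (maximalIdeal A).fg_of_isNoetherianRing,
    RingHom.mem_ker, map_sub, sub_eq_zero]
  exact (DFunLike.congr_fun hσ (evalOneₐ (maximalIdeal A) r)).symm

theorem exists_algebra_mvPowerSeries_maxAdicCompletion (p : ℕ) [Fact p.Prime] [CharP A p]
    {ι : Type*} [Finite ι] {x : ι → A} (hx : ∀ i, x i ∈ maximalIdeal A) :
    ∃ (_ : Algebra (ResidueField A) (MaxAdicCompletion A))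
      (_ : Algebra (MvPowerSeries ι (ResidueField A)) (MaxAdicCompletion A))
      (_ : IsScalarTower (ResidueField A) (MvPowerSeries ι (ResidueField A))
        (MaxAdicCompletion A)),
      (∀ r, ∃ c : ResidueField A, r - algebraMap _ (MaxAdicCompletion A) c ∈
        maximalIdeal (MaxAdicCompletion A)) ∧
      ∀ i, algebraMap (MvPowerSeries ι (ResidueField A)) (MaxAdicCompletion A)
        (MvPowerSeries.X i) = algebraMap A (MaxAdicCompletion A) (x i) := by
  obtain ⟨σ, hσ⟩ := exists_ringHom_residueField_maxAdicCompletion (A := A) p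
  obtain ⟨φ, hφC, hφX⟩ := exists_ringHom_mvPowerSeries (maximalIdeal (MaxAdicCompletion A)) σ
    (fun i => algebraMap A (MaxAdicCompletion A) (x i)) fun i => by
      rw [maximalIdeal_eq_map]
      exact Ideal.mem_map_of_mem _ (hx i)
  let : Algebra (ResidueField A) (MaxAdicCompletion A) := σ.toAlgebra
  let : Algebra (MvPowerSeries ι (ResidueField A)) (MaxAdicCompletion A) := φ.toAlgebra
  exact ⟨inferInstance, inferInstance, .of_algebraMap_eq fun c => (hφC c).symm, hσ, hφX⟩

theorem map_span_range_eq_map_span_range {P A R ι : Type*} [CommRing P] [CommRing A] [CommRing R]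
    [Algebra P R] [Algebra A R] {y : ι → P} {x : ι → A}
    (h : ∀ i, algebraMap P R (y i) = algebraMap A R (x i)) :
    (Ideal.span (Set.range y)).map (algebraMap P R) =
      (Ideal.span (Set.range x)).map (algebraMap A R) := by
  rw [Ideal.map_span, Ideal.map_span, ← Set.range_comp, ← Set.range_comp]
  exact congrArg (fun f => Ideal.span (Set.range f)) (funext h)

theorem IsCohenMacaulayLocal.nonempty_basis_maxAdicCompletion (hCM : IsCohenMacaulayLocal A)
    {k : Type*} [Field k] [Algebra k (MaxAdicCompletion A)] {d : ℕ}
    [Algebra (MvPowerSeries (Fin d) k) (MaxAdicCompletion A)]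
    [IsScalarTower k (MvPowerSeries (Fin d) k) (MaxAdicCompletion A)]
    (hk : ∀ r, ∃ c : k, r - algebraMap k (MaxAdicCompletion A) c ∈
      maximalIdeal (MaxAdicCompletion A))
    (hdim : ringKrullDim A = (d : WithBot ℕ∞)) {x : Fin d → A} (hx : ∀ i, x i ∈ maximalIdeal A)
    (hX : ∀ i, algebraMap (MvPowerSeries (Fin d) k) (MaxAdicCompletion A) (MvPowerSeries.X i) =
      algebraMap A (MaxAdicCompletion A) (x i))
    {N : ℕ} (hN : maximalIdeal A ^ N ≤ Ideal.span (Set.range x)) :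
    Nonempty (Module.Basis (Fin (Module.length A (A ⧸ Ideal.span (Set.range x))).toNat)
      (MvPowerSeries (Fin d) k) (MaxAdicCompletion A)) := by
  have hhausdorff : IsHausdorff (Ideal.span (Set.range MvPowerSeries.X) :
      Ideal (MvPowerSeries (Fin d) k)) (MaxAdicCompletion A) := by
    refine IsHausdorff.of_map (J := maximalIdeal (MaxAdicCompletion A)) ?_
    rw [Ideal.map_span, Ideal.span_le]
    rintro _ ⟨_, ⟨i, rfl⟩, rfl⟩
    rw [hX i, maximalIdeal_eq_map]
    exact Ideal.mem_map_of_mem _ (hx i)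
  have hfinite : Module.length A (A ⧸ Ideal.span (Set.range x)) ≠ ⊤ :=
    Module.length_ne_top_iff.mpr (isFiniteLength_quotient_of_maximalIdeal_pow_le hN)
  have hle : Ideal.span (Set.range x) ≤ maximalIdeal A :=
    Ideal.span_le.mpr (Set.range_subset_iff.mpr hx)
  refine exists_basis_of_finrank_quotient_varPow (toNat_length_quotient_ne_zero hN hle)
    fun q hq => ?_
  obtain ⟨N', hN'⟩ : ∃ N', maximalIdeal A ^ N' ≤ Ideal.span (Set.range fun i => x i ^ q) :=
    exists_maximalIdeal_pow_le_of_pow_mem hN (q := q)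
      (Set.forall_mem_range.mpr fun i => Ideal.subset_span ⟨i, rfl⟩)
  have hmap : (varPow k d q).map (algebraMap _ (MaxAdicCompletion A)) =
      (Ideal.span (Set.range fun i => x i ^ q)).map (algebraMap A (MaxAdicCompletion A)) :=
    map_span_range_eq_map_span_range fun i => by rw [map_pow, map_pow, hX]
  have hlength := hCM.length_quotient_span_range_pow (by simpa using hdim) hx
    (fun a ha => ⟨N, hN (Ideal.pow_mem_pow ha N)⟩) (n := fun _ => q) (fun _ => hq)
  rw [length_quotient_eq_finrank_quotient_map hk hN', ← hmap,
    ← ENat.natCast_toNat hfinite, Finset.prod_const, Finset.card_univ, Fintype.card_fin] at hlength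
  rw [mul_comm]
  exact_mod_cast hlength

end Completion

/-! ### Multiplicities -/

section HilbertKunz

open IsLocalRing

variable {A : Type u} [CommRing A] [IsLocalRing A] [IsNoetherianRing A]

theorem IsCohenMacaulayLocal.exists_tendsto_hilbertKunzSeq (p : ℕ) [Fact p.Prime] [CharP A p]
    (hCM : IsCohenMacaulayLocal A) {d : ℕ} (hd : d ≠ 0)
    (hdim : ringKrullDim A = (d : WithBot ℕ∞))
    {x : Fin d → A} (hx : ∀ i, x i ∈ maximalIdeal A) {N : ℕ}
    (hN : maximalIdeal A ^ N ≤ Ideal.span (Set.range x)) {I : Ideal A}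
    (hxI : Ideal.span (Set.range x) ≤ I) (hI : I ^ 2 ≤ Ideal.span (Set.range x)) :
    ∃ L : ℝ, Tendsto (hilbertKunzSeq p d I) atTop (𝓝 L) ∧
      colength (Ideal.span (Set.range x)) / 2 ≤ L := by
  let R := MaxAdicCompletion A
  obtain ⟨_, _, _, hk, hX⟩ := exists_algebra_mvPowerSeries_maxAdicCompletion p hx
  obtain ⟨b⟩ := hCM.nonempty_basis_maxAdicCompletion hk hdim hx hX hN
  have : CharP (ResidueField A) p := by
    rw [CharP.charP_iff_prime_eq_zero Fact.out, ← map_natCast (residue A), CharP.cast_eq_zero,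
      map_zero]
  have hlength_ne_zero : (Module.length A (A ⧸ Ideal.span (Set.range x))).toNat ≠ 0 :=
    toNat_length_quotient_ne_zero hN (Ideal.span_le.mpr (Set.range_subset_iff.mpr hx))
  have := Fin.pos_iff_nonempty.mp (Nat.pos_of_ne_zero hlength_ne_zero)
  have hmap_x : Ideal.span (Set.range fun i =>
      algebraMap (MvPowerSeries (Fin d) (ResidueField A)) R (MvPowerSeries.X i)) =
        (Ideal.span (Set.range x)).map (algebraMap A R) := by
    rw [Ideal.map_span, ← Set.range_comp]
    exact congrArg (fun f => Ideal.span (Set.range f)) (funext hX)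
  obtain ⟨L, hL, hle⟩ := exists_tendsto_finrank_quotient_powSpan p hd b
    (S := algebraMap A R '' (I : Set A))
    (fun i => ⟨x i, hxI (Ideal.subset_span ⟨i, rfl⟩), (hX i).symm⟩) (by
      rintro _ ⟨a, ha, rfl⟩ _ ⟨c, hc, rfl⟩
      rw [hmap_x, ← map_mul]
      exact Ideal.mem_map_of_mem _ (hI (pow_two I ▸ Ideal.mul_mem_mul ha hc)))
  refine ⟨L, hL.congr fun t => ?_, by simpa [colength] using hle⟩
  have hmap_I : powSpan (algebraMap A R '' I) (p ^ t) =
      (frobeniusPower I (p ^ t)).map (algebraMap A R) := by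
    rw [powSpan, frobeniusPower, Ideal.map_span, Set.image_image, Set.image_image]
    simp only [map_pow]
  obtain ⟨N', hN'⟩ : ∃ N', maximalIdeal A ^ N' ≤ frobeniusPower I (p ^ t) :=
    exists_maximalIdeal_pow_le_of_pow_mem hN (q := p ^ t) fun a ha =>
      Ideal.subset_span ⟨a, hxI (Ideal.subset_span ha), rfl⟩
  rw [hilbertKunzSeq, colength, length_quotient_eq_finrank_quotient_map hk hN', hmap_I,
    ENat.toNat_natCast]

end HilbertKunz

section Multiplicity

open IsLocalRing

theorem tendsto_factorial_div_pow_mul_choose (d a b : ℕ) :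
    Tendsto (fun n : ℕ => (d.factorial : ℝ) / ((n + a : ℕ) : ℝ) ^ d * ((n + b).choose d : ℝ))
      atTop (𝓝 1) := by
  have hchoose : Tendsto (fun n : ℕ => ((n.choose d : ℝ) / ((n : ℝ) ^ d / d.factorial)))
      atTop (𝓝 1) :=
    (Asymptotics.isEquivalent_iff_tendsto_one (by
      filter_upwards [eventually_gt_atTop 0] with n hn
      have := d.factorial_pos
      positivity)).mp (isEquivalent_choose d)
  have hratio : Tendsto (fun n : ℕ => (((n : ℝ) / (n + a)) / ((n : ℝ) / (n + b))) ^ d)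
      atTop (𝓝 1) := by
    simpa using ((tendsto_natCast_div_add_atTop (a : ℝ)).div
      (tendsto_natCast_div_add_atTop (b : ℝ)) one_ne_zero).pow d
  have hmul := hratio.mul ((tendsto_add_atTop_iff_nat b).mpr hchoose)
  rw [one_mul] at hmul
  refine hmul.congr' ?_
  filter_upwards [eventually_gt_atTop 0] with n hn
  have : (0 : ℝ) < n := by exact_mod_cast hn
  have : (d.factorial : ℝ) ≠ 0 := by exact_mod_cast d.factorial_ne_zero
  have hab : (n : ℝ) / (n + a) / (n / (n + b)) = (n + b) / (n + a) := by field_simp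
  rw [hab, div_pow]
  push_cast
  field_simp

theorem pow_add_eq_of_pow_succ_eq_mul {M : Type*} [Monoid M] {x y : M} {r : ℕ}
    (h : y ^ (r + 1) = x * y ^ r) (m : ℕ) : y ^ (r + m) = x ^ m * y ^ r := by
  induction m with
  | zero => simp
  | succ m ih => rw [← add_assoc, pow_succ, ih, mul_assoc, ← pow_succ, h, pow_succ, mul_assoc]

variable {A : Type u} [CommRing A] [IsLocalRing A] [IsNoetherianRing A]

theorem colength_anti {I K : Ideal A} {N : ℕ} (hI : maximalIdeal A ^ N ≤ I) (hIK : I ≤ K) :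
    colength K ≤ colength I := by
  rw [colength, colength]
  exact_mod_cast ENat.toNat_le_toNat
    (Module.length_le_of_surjective (Submodule.factor hIK) (Submodule.factor_surjective hIK))
    (Module.length_ne_top_iff.mpr (isFiniteLength_quotient_of_maximalIdeal_pow_le hI))

variable {d : ℕ} {x : Fin d → A} {N : ℕ}

theorem IsCohenMacaulayLocal.colength_span_range_pow (p : ℕ) [Fact p.Prime] [CharP A p]
    (hCM : IsCohenMacaulayLocal A) (hdim : ringKrullDim A = (d : WithBot ℕ∞))
    (hx : ∀ i, x i ∈ maximalIdeal A) (hN : maximalIdeal A ^ N ≤ Ideal.span (Set.range x)) (n : ℕ) :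
    colength (Ideal.span (Set.range x) ^ (n + 1)) =
      colength (Ideal.span (Set.range x)) * (n + d).choose d := by
  obtain ⟨_, _, _, hk, hX⟩ := exists_algebra_mvPowerSeries_maxAdicCompletion p hx
  obtain ⟨b⟩ := hCM.nonempty_basis_maxAdicCompletion hk hdim hx hX hN
  have hmap : (Ideal.span (Set.range x) ^ (n + 1)).map (algebraMap A (MaxAdicCompletion A)) =
      (Ideal.span (Set.range MvPowerSeries.X) ^ (n + 1)).map
        (algebraMap (MvPowerSeries (Fin d) (ResidueField A)) (MaxAdicCompletion A)) := by
    rw [Ideal.map_pow, Ideal.map_pow, map_span_range_eq_map_span_range hX]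
  have hpow : maximalIdeal A ^ (N * (n + 1)) ≤ Ideal.span (Set.range x) ^ (n + 1) := by
    rw [pow_mul]
    exact Ideal.pow_right_mono hN _
  rw [colength, length_quotient_eq_finrank_quotient_map hk hpow, hmap, ENat.toNat_natCast,
    finrank_quotient_map b, finrank_quotient_span_range_X_pow, Fintype.card_fin, Nat.cast_mul,
    colength]

-- If `J = (x)` and `I ^ (r + 1) = J * I ^ r`, then the Hilbert function of `I` is squeezed between
-- two shifts of that of `J`, because `J ^ (n + r + 1) ≤ I ^ (n + r + 1) ≤ J ^ (n + 1)`.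
theorem IsCohenMacaulayLocal.tendsto_multiplicitySeq (p : ℕ) [Fact p.Prime] [CharP A p]
    (hCM : IsCohenMacaulayLocal A) (hdim : ringKrullDim A = (d : WithBot ℕ∞))
    (hx : ∀ i, x i ∈ maximalIdeal A) (hN : maximalIdeal A ^ N ≤ Ideal.span (Set.range x))
    {I : Ideal A} (hI : IsReduction (Ideal.span (Set.range x)) I) :
    Tendsto (multiplicitySeq d I) atTop (𝓝 (colength (Ideal.span (Set.range x)))) := by
  obtain ⟨hle, r, hr⟩ := hI
  let J := Ideal.span (Set.range x)
  have hpow (n : ℕ) : maximalIdeal A ^ (N * n) ≤ J ^ n := by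
    rw [pow_mul]
    exact Ideal.pow_right_mono hN _
  have hlimit (s : ℕ) : Tendsto (fun n : ℕ => colength J *
      ((d.factorial : ℝ) / ((n + r : ℕ) : ℝ) ^ d * ((n + s).choose d : ℝ)))
      atTop (𝓝 (colength J)) := by
    simpa using (tendsto_factorial_div_pow_mul_choose d r s).const_mul (colength J)
  rw [← tendsto_add_atTop_iff_nat r]
  refine tendsto_of_tendsto_of_tendsto_of_le_of_le (hlimit d) (hlimit (r + d)) (fun n => ?_)
    fun n => ?_
  · have hIJ : I ^ (n + r + 1) ≤ J ^ (n + 1) := by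
      rw [show n + r + 1 = r + (n + 1) by ring, pow_add_eq_of_pow_succ_eq_mul hr]
      exact Ideal.mul_le_left
    have hcolength := colength_anti ((hpow (n + r + 1)).trans (Ideal.pow_right_mono hle _)) hIJ
    rw [hCM.colength_span_range_pow p hdim hx hN] at hcolength
    dsimp only [multiplicitySeq]
    rw [mul_left_comm]
    gcongr
  · have hcolength := colength_anti (hpow (n + r + 1)) (Ideal.pow_right_mono hle (n + r + 1))
    rw [hCM.colength_span_range_pow p hdim hx hN, add_assoc n r d] at hcolength
    dsimp only [multiplicitySeq]
    rw [mul_left_comm]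
    gcongr

end Multiplicity

/-! ### Reductions -/

section Relations

open IsLocalRing MvPolynomial

variable {A : Type u} [CommRing A] [IsLocalRing A]

theorem exists_maximalIdeal_le_radical_span_range [IsNoetherianRing A] {d : ℕ}
    (hdim : ringKrullDim A = (d : WithBot ℕ∞)) :
    ∃ x : Fin d → A, (∀ i, x i ∈ maximalIdeal A) ∧
      maximalIdeal A ≤ (Ideal.span (Set.range x)).radical := by
  obtain ⟨s, hs, hcard⟩ := (maximalIdeal A).exists_finset_card_eq_height_of_isNoetherianRing
  rw [← maximalIdeal_height_eq_ringKrullDim, ← hcard] at hdim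
  let x : Fin d → A := fun i => (s.equivFinOfCardEq (by exact_mod_cast hdim)).symm i
  have hx : Set.range x = s := by
    rw [show x = Subtype.val ∘ (s.equivFinOfCardEq _).symm from rfl, Set.range_comp,
      Equiv.range_eq_univ, Set.image_univ, Subtype.range_coe]
  refine ⟨x, fun i => hs.1.2 (Ideal.subset_span (hx ▸ ⟨i, rfl⟩)), ?_⟩
  rw [hx, Ideal.radical_eq_sInf]
  exact le_sInf fun P ⟨hle, hP⟩ => hs.2 ⟨hP, hle⟩ (le_maximalIdeal hP.ne_top)

theorem IsCohenMacaulayLocal.exists_length_quotient_pow_le [IsNoetherianRing A]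
    (hCM : IsCohenMacaulayLocal A) {d : ℕ} (hdim : ringKrullDim A = (d : WithBot ℕ∞)) {J : Ideal A}
    {M : ℕ} (hM : maximalIdeal A ^ M ≤ J) :
    ∃ C : ℕ, ∀ n, n ≠ 0 → Module.length A (A ⧸ J ^ n) ≤ (C * n ^ d : ℕ) := by
  obtain ⟨x, hx, hrad⟩ := exists_maximalIdeal_le_radical_span_range hdim
  obtain ⟨N, hN⟩ := Ideal.exists_pow_le_of_le_radical_of_fg hrad (IsNoetherian.noetherian _)
  have hfinite : Module.length A (A ⧸ Ideal.span (Set.range x)) ≠ ⊤ :=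
    Module.length_ne_top_iff.mpr (isFiniteLength_quotient_of_maximalIdeal_pow_le hN)
  refine ⟨(M + 1) ^ d * (Module.length A (A ⧸ Ideal.span (Set.range x))).toNat, fun n hn => ?_⟩
  have hle : Ideal.span (Set.range fun i => x i ^ ((M + 1) * n)) ≤ J ^ n := by
    rw [Ideal.span_le]
    rintro _ ⟨i, rfl⟩
    change x i ^ ((M + 1) * n) ∈ J ^ n
    rw [pow_mul]
    exact Ideal.pow_mem_pow (hM (Ideal.pow_le_pow_right M.le_succ
      (Ideal.pow_mem_pow (hx i) _))) n
  calc Module.length A (A ⧸ J ^ n)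
      ≤ Module.length A (A ⧸ Ideal.span (Set.range fun i => x i ^ ((M + 1) * n))) :=
        Module.length_le_of_surjective (Submodule.factor hle) (Submodule.factor_surjective hle)
    _ = (((M + 1) * n) ^ d : ℕ) * Module.length A (A ⧸ Ideal.span (Set.range x)) := by
        rw [hCM.length_quotient_span_range_pow (by rwa [Fintype.card_fin]) hx hrad
          (fun _ => mul_ne_zero M.succ_ne_zero hn), Finset.prod_const, Finset.card_univ,
          Fintype.card_fin]
    _ = _ := by
        rw [← ENat.natCast_toNat hfinite, ENat.toNat_natCast, ← Nat.cast_mul, mul_pow,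
          mul_right_comm]

theorem card_add_length_quotient_le {M ι : Type*} [AddCommGroup M] [Module A M] [Fintype ι]
    {N : Submodule A M} {v : ι → M} (hv : ∀ i, v i ∈ N)
    (h : ∀ c : ι → A, ∑ i, c i • v i ∈ maximalIdeal A • N → ∀ i, c i ∈ maximalIdeal A) :
    (Fintype.card ι : ℕ∞) + Module.length A (M ⧸ N) ≤
      Module.length A (M ⧸ maximalIdeal A • N) := by
  classical
  have hle : maximalIdeal A • N ≤ N := Submodule.smul_le_right
  let π : (M ⧸ maximalIdeal A • N) →ₗ[A] M ⧸ N := Submodule.factor hle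
  let φ : (ι → A) →ₗ[A] M ⧸ maximalIdeal A • N :=
    (maximalIdeal A • N).mkQ ∘ₗ Fintype.linearCombination A v
  have hrange : LinearMap.range φ ≤ LinearMap.ker π := by
    rintro _ ⟨c, rfl⟩
    exact (Submodule.Quotient.mk_eq_zero _).mpr (sum_mem fun i _ => N.smul_mem _ (hv i))
  have hker : LinearMap.ker φ ≤ Submodule.pi Set.univ fun _ => maximalIdeal A := fun c hc i _ =>
    h c ((Submodule.Quotient.mk_eq_zero _).mp hc) i
  have : IsSimpleModule A (A ⧸ maximalIdeal A) :=
    isSimpleModule_iff_isCoatom.mpr (maximalIdeal.isMaximal A).out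
  rw [Module.length_eq_add_of_exact (LinearMap.ker π).subtype π
    (LinearMap.ker π).injective_subtype (Submodule.factor_surjective hle)
    (LinearMap.exact_subtype_ker_map π)]
  gcongr
  calc (Fintype.card ι : ℕ∞)
      = Module.length A (ι → A ⧸ maximalIdeal A) := by
        simp [Module.length_pi_of_fintype]
    _ = Module.length A ((ι → A) ⧸ Submodule.pi Set.univ fun _ => maximalIdeal A) :=
        (Submodule.quotientPi fun _ => maximalIdeal A).symm.length_eq
    _ ≤ Module.length A ((ι → A) ⧸ LinearMap.ker φ) :=
        Module.length_le_of_surjective (Submodule.factor hker) (Submodule.factor_surjective hker)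
    _ = Module.length A (LinearMap.range φ) := φ.quotKerEquivRange.length_eq
    _ ≤ Module.length A (LinearMap.ker π) :=
        Module.length_le_of_injective (Submodule.inclusion hrange)
          (Submodule.inclusion_injective hrange)

theorem multichoose_add_length_quotient_pow_le {r n : ℕ} {a : Fin r → A}
    (ha : ∀ i, a i ∈ maximalIdeal A)
    (h : ∀ f : MvPolynomial (Fin r) A, f.IsHomogeneous n →
      eval a f ∈ maximalIdeal A * Ideal.span (Set.range a) ^ n → map (residue A) f = 0) :
    (r.multichoose n : ℕ∞) + Module.length A (A ⧸ Ideal.span (Set.range a) ^ n) ≤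
      Module.length A (A ⧸ Ideal.span (Set.range a) ^ (n + 1)) := by
  classical
  let J := Ideal.span (Set.range a)
  let E : Finset (Fin r →₀ ℕ) := Finset.univ.finsuppAntidiag n
  have hdegree (α : E) : α.1.degree = n := by
    rw [Finsupp.degree_eq_sum, (Finset.mem_finsuppAntidiag.mp α.2).1]
  have hmem (α : E) : eval a (monomial α.1 1) ∈ J ^ n :=
    (Ideal.mem_span_pow_iff_exists_isHomogeneous a _).mpr
      ⟨_, isHomogeneous_monomial 1 (hdegree α), rfl⟩
  have hindependent (c : E → A) (hc : ∑ α, c α • eval a (monomial α.1 1) ∈ maximalIdeal A • J ^ n)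
      (β : E) : c β ∈ maximalIdeal A := by
    have hzero := congrArg (coeff β.1) (h (∑ α, monomial α.1 (c α))
      (IsHomogeneous.sum _ _ _ fun α _ => isHomogeneous_monomial _ (hdegree α))
      (by simpa [eval_monomial] using hc))
    rw [coeff_map, coeff_sum, Finset.sum_eq_single_of_mem β (Finset.mem_univ β) fun α _ hαβ =>
      by rw [coeff_monomial, if_neg fun h => hαβ (Subtype.ext h)]] at hzero
    simpa using hzero
  have hle : J ^ (n + 1) ≤ maximalIdeal A • J ^ n := by
    rw [pow_succ', smul_eq_mul]
    exact Ideal.mul_mono_left (Ideal.span_le.mpr (Set.range_subset_iff.mpr ha))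
  calc (r.multichoose n : ℕ∞) + Module.length A (A ⧸ J ^ n)
      = Fintype.card E + Module.length A (A ⧸ J ^ n) := by
        rw [Fintype.card_coe, Finset.card_finsuppAntidiag_nat_eq_multichoose, Finset.card_univ,
          Fintype.card_fin]
    _ ≤ Module.length A (A ⧸ maximalIdeal A • J ^ n) :=
        card_add_length_quotient_le hmem hindependent
    _ ≤ Module.length A (A ⧸ J ^ (n + 1)) :=
        Module.length_le_of_surjective (Submodule.factor hle) (Submodule.factor_surjective hle)

theorem exists_mul_pow_lt_choose (C : ℕ) {d r : ℕ} (hr : d < r) :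
    ∃ n : ℕ, C * (n + 1) ^ d < (n + r).choose r := by
  refine ⟨C * r.factorial, lt_of_mul_lt_mul_left ?_ r.factorial.zero_le⟩
  calc r.factorial * (C * (C * r.factorial + 1) ^ d)
      = C * r.factorial * (C * r.factorial + 1) ^ d := by ring
    _ < (C * r.factorial + 1) * (C * r.factorial + 1) ^ d :=
        Nat.mul_lt_mul_of_pos_right (Nat.lt_succ_self _) (by positivity)
    _ = (C * r.factorial + 1) ^ (d + 1) := by ring
    _ ≤ (C * r.factorial + 1) ^ r := Nat.pow_le_pow_right (Nat.succ_pos _) hr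
    _ ≤ (C * r.factorial + r).descFactorial r := by
        have := Nat.pow_sub_le_descFactorial (C * r.factorial + r) r
        rwa [show C * r.factorial + r + 1 - r = C * r.factorial + 1 by omega] at this
    _ = r.factorial * (C * r.factorial + r).choose r :=
        Nat.descFactorial_eq_factorial_mul_choose _ _

theorem IsCohenMacaulayLocal.exists_isHomogeneous_eval_mem [IsNoetherianRing A]
    (hCM : IsCohenMacaulayLocal A) {d : ℕ} (hdim : ringKrullDim A = (d : WithBot ℕ∞))
    {r : ℕ} (hr : d < r) {a : Fin r → A} (ha : ∀ i, a i ∈ maximalIdeal A) {M : ℕ}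
    (hM : maximalIdeal A ^ M ≤ Ideal.span (Set.range a)) :
    ∃ n, ∃ f : MvPolynomial (Fin r) A, f.IsHomogeneous n ∧
      eval a f ∈ maximalIdeal A * Ideal.span (Set.range a) ^ n ∧ map (residue A) f ≠ 0 := by
  by_contra! hindependent
  obtain ⟨C, hC⟩ := hCM.exists_length_quotient_pow_le hdim hM
  have hlower (m : ℕ) : ((∑ i ∈ Finset.range m, r.multichoose i : ℕ) : ℕ∞) ≤
      Module.length A (A ⧸ Ideal.span (Set.range a) ^ m) := by
    induction m with
    | zero => simp
    | succ m ih =>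
      rw [Finset.sum_range_succ, Nat.cast_add, add_comm]
      exact (add_le_add_right ih _).trans
        (multichoose_add_length_quotient_pow_le ha (hindependent m))
  obtain ⟨n, hn⟩ := exists_mul_pow_lt_choose C hr
  have hle := (hlower (n + 1)).trans (hC (n + 1) n.succ_ne_zero)
  rw [Nat.sum_range_multichoose, Nat.cast_le] at hle
  exact hn.not_ge hle

theorem eval_mul_eq_eval_mul_pow {R σ : Type*} [CommSemiring R] {f : MvPolynomial σ R}
    {n : ℕ} (hf : f.IsHomogeneous n) (u : σ → R) (t : R) :
    eval (fun i => u i * t) f = eval u f * t ^ n := by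
  rw [eval_eq, eval_eq, Finset.sum_mul]
  refine Finset.sum_congr rfl fun α hα => ?_
  simp only [mul_pow, Finset.prod_mul_distrib, Finset.prod_pow_eq_pow_sum,
    ← hf.degree_eq_sum_deg_support hα, mul_assoc]

theorem exists_isUnit_eval [Infinite (ResidueField A)] {σ : Type*} {n : ℕ} (hn : n ≠ 0)
    {f : MvPolynomial σ A} (hf : f.IsHomogeneous n) (hres : map (residue A) f ≠ 0) :
    ∃ (j : σ) (u : σ → A), u j = 1 ∧ IsUnit (eval u f) := by
  obtain ⟨c, hc⟩ : ∃ c, eval c (map (residue A) f) ≠ 0 := by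
    by_contra! h
    exact hres (MvPolynomial.funext fun c => by rw [h c, map_zero])
  choose v hv using fun i => residue_surjective (c i)
  obtain rfl : (fun i => residue A (v i)) = c := _root_.funext hv
  rw [eval_map, ← Function.comp_def, ← eval₂_comp, residue_ne_zero_iff_isUnit] at hc
  obtain ⟨j, hj⟩ : ∃ j, IsUnit (v j) := by
    by_contra! hnonunit
    have hmem := (Ideal.mem_span_pow_iff_exists_isHomogeneous v _).mpr ⟨f, hf, rfl⟩
    exact (mem_maximalIdeal _).mp (Ideal.span_le.mpr (Set.range_subset_iff.mpr hnonunit)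
      (Ideal.pow_le_self hn hmem)) hc
  obtain ⟨w, hw⟩ := hj.exists_right_inv
  refine ⟨j, fun i => v i * w, hw, ?_⟩
  rw [eval_mul_eq_eval_mul_pow hf]
  exact hc.mul ((IsUnit.of_mul_eq_one_right _ hw).pow n)

end Relations

section Reduction

open IsLocalRing MvPolynomial

theorem eval_sub_eval_mem {A σ : Type*} [CommRing A] {K : Ideal A} {a g : σ → A}
    (hag : ∀ i, a i - g i ∈ K) (f : MvPolynomial σ A) : eval a f - eval g f ∈ K := by
  rw [← Ideal.Quotient.eq, eval₂_comp, eval₂_comp]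
  exact congrArg (fun v => eval₂ _ v f) (_root_.funext fun i => Ideal.Quotient.eq.mpr (hag i))

theorem eval_sub_eval_mem_mul_pow {A σ : Type*} [CommRing A] {K J : Ideal A} {a g : σ → A}
    (ha : ∀ i, a i ∈ J) (hg : ∀ i, g i ∈ J) (hag : ∀ i, a i - g i ∈ K) {n : ℕ}
    {f : MvPolynomial σ A} (hf : f.IsHomogeneous (n + 1)) :
    eval a f - eval g f ∈ K * J ^ n := by
  induction n generalizing f with
  | zero => simpa using eval_sub_eval_mem hag f
  | succ n ih =>
    rw [← mem_homogeneousSubmodule, ← homogeneousSubmodule_one_pow, pow_succ',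
      homogeneousSubmodule_one_pow] at hf
    induction hf using Submodule.mul_induction_on' with
    | mem_mul_mem l hl φ hφ =>
      have hφJ : eval a φ ∈ J ^ (n + 1) :=
        Ideal.pow_right_mono (Ideal.span_le.mpr (Set.range_subset_iff.mpr ha)) _
          ((Ideal.mem_span_pow_iff_exists_isHomogeneous a _).mpr ⟨φ, hφ, rfl⟩)
      have hlJ : eval g l ∈ J :=
        Ideal.span_le.mpr (Set.range_subset_iff.mpr hg)
          ((Ideal.mem_span_iff_exists_isHomogeneous g _).mpr ⟨l, hl, rfl⟩)
      have hmul := Ideal.mul_mem_mul (ih hφ) hlJ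
      rw [mul_assoc, ← pow_succ] at hmul
      convert Ideal.add_mem _ (Ideal.mul_mem_mul (eval_sub_eval_mem hag l) hφJ) hmul using 1
      rw [map_mul, map_mul]
      ring
    | add φ _ ψ _ hφ hψ =>
      rw [map_add, map_add, add_sub_add_comm]
      exact Ideal.add_mem _ hφ hψ

variable {A : Type u} [CommRing A] [IsLocalRing A] [IsNoetherianRing A]

-- Modulo `K * J ^ n`, every form `φ` of degree `n + 1` satisfies `φ(a) = φ(u) * (a j) ^ (n + 1)`.
theorem isReduction_of_isUnit_eval {σ : Type*} {a u : σ → A} {j : σ} {K : Ideal A}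
    (hK : K ≤ Ideal.span (Set.range a)) (hau : ∀ i, a i - u i * a j ∈ K) {n : ℕ}
    {f : MvPolynomial σ A} (hf : f.IsHomogeneous (n + 1)) (hunit : IsUnit (eval u f))
    (hmem : eval a f ∈ maximalIdeal A * Ideal.span (Set.range a) ^ (n + 1)) :
    IsReduction K (Ideal.span (Set.range a)) := by
  set J := Ideal.span (Set.range a)
  have ha (i : σ) : a i ∈ J := Ideal.subset_span ⟨i, rfl⟩
  have hcongr {φ : MvPolynomial σ A} (hφ : φ.IsHomogeneous (n + 1)) :
      eval a φ - eval u φ * a j ^ (n + 1) ∈ K * J ^ n ⊔ maximalIdeal A • J ^ (n + 1) := by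
    rw [← eval_mul_eq_eval_mul_pow hφ]
    exact Ideal.mem_sup_left
      (eval_sub_eval_mem_mul_pow ha (fun i => J.mul_mem_left (u i) (ha j)) hau hφ)
  have hpow : a j ^ (n + 1) ∈ K * J ^ n ⊔ maximalIdeal A • J ^ (n + 1) :=
    (Ideal.unit_mul_mem_iff_mem _ hunit).mp
      ((Submodule.sub_mem_iff_right _ (Submodule.mem_sup_right hmem)).mp (hcongr hf))
  have hle : J ^ (n + 1) ≤ K * J ^ n ⊔ maximalIdeal A • J ^ (n + 1) := fun y hy => by
    obtain ⟨φ, hφ, rfl⟩ := (Ideal.mem_span_pow_iff_exists_isHomogeneous a y).mp hy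
    exact (Submodule.sub_mem_iff_left _ (Ideal.mul_mem_left _ _ hpow)).mp (hcongr hφ)
  refine ⟨hK, n, le_antisymm ?_ ?_⟩
  · exact Submodule.le_of_le_smul_of_le_jacobson_bot (IsNoetherian.noetherian _)
      (jacobson_eq_maximalIdeal ⊥ bot_ne_top).ge hle
  · rw [pow_succ']
    exact Ideal.mul_mono_left hK

theorem exists_isReduction_span_range [Infinite (ResidueField A)] {r n : ℕ} {a : Fin (r + 1) → A}
    {f : MvPolynomial (Fin (r + 1)) A} (hf : f.IsHomogeneous n)
    (hmem : eval a f ∈ maximalIdeal A * Ideal.span (Set.range a) ^ n)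
    (hres : map (residue A) f ≠ 0) :
    ∃ b : Fin r → A, IsReduction (Ideal.span (Set.range b)) (Ideal.span (Set.range a)) := by
  cases n with
  | zero =>
    obtain ⟨c, rfl⟩ : ∃ c, f = C c := 
      ⟨_, totalDegree_eq_zero_iff_eq_C.mp (Nat.le_zero.mp hf.totalDegree_le)⟩
    refine absurd ?_ hres
    rw [map_C, C_eq_zero, residue_eq_zero_iff]
    simpa using hmem
  | succ n =>
    obtain ⟨j, u, huj, hunit⟩ := exists_isUnit_eval n.succ_ne_zero hf hres
    refine ⟨fun i => a (j.succAbove i) - u (j.succAbove i) * a j,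
      isReduction_of_isUnit_eval (j := j) ?_ (fun i => ?_) hf hunit hmem⟩
    · rw [Ideal.span_le]
      rintro _ ⟨i, rfl⟩
      exact Ideal.sub_mem _ (Ideal.subset_span ⟨_, rfl⟩)
        (Ideal.mul_mem_left _ _ (Ideal.subset_span ⟨j, rfl⟩))
    · rcases Fin.eq_self_or_eq_succAbove j i with rfl | ⟨i, rfl⟩
      · simp [huj]
      · exact Ideal.subset_span ⟨i, rfl⟩

theorem IsReduction.trans {A : Type u} [CommRing A] {K J I : Ideal A} (hKJ : IsReduction K J)
    (hJI : IsReduction J I) : IsReduction K I := by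
  obtain ⟨hKJ, m, hm⟩ := hKJ
  obtain ⟨hJI, n, hn⟩ := hJI
  refine ⟨hKJ.trans hJI, n + m, ?_⟩
  rw [add_assoc, pow_add_eq_of_pow_succ_eq_mul hn, pow_add_eq_of_pow_succ_eq_mul hn, hm, mul_assoc]

theorem exists_span_range_eq_of_le {A : Type*} [Semiring A] {r d : ℕ} (hrd : r ≤ d)
    (a : Fin r → A) : ∃ x : Fin d → A, Ideal.span (Set.range x) = Ideal.span (Set.range a) := by
  refine ⟨Function.extend (Fin.castLE hrd) a 0, le_antisymm (Ideal.span_le.mpr ?_)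
    (Ideal.span_mono ?_)⟩
  · refine (Set.range_extend_subset _ _ _).trans (Set.union_subset Ideal.subset_span ?_)
    rintro _ ⟨i, -, rfl⟩
    exact Ideal.zero_mem _
  · rintro _ ⟨i, rfl⟩
    exact ⟨Fin.castLE hrd i, (Fin.castLE_injective hrd).extend_apply _ _ _⟩

theorem IsMinimalReduction.exists_eq_span_range [Infinite (ResidueField A)]
    (hCM : IsCohenMacaulayLocal A) {d : ℕ} (hdim : ringKrullDim A = (d : WithBot ℕ∞))
    {J I : Ideal A} (hJI : IsMinimalReduction J I) (hJ : J ≤ maximalIdeal A) {M : ℕ}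
    (hM : maximalIdeal A ^ M ≤ J) : ∃ x : Fin d → A, J = Ideal.span (Set.range x) := by
  suffices hdescent : ∀ r, (∃ a : Fin r → A, J = Ideal.span (Set.range a)) →
      ∃ x : Fin d → A, J = Ideal.span (Set.range x) by
    obtain ⟨r, a, ha⟩ := Submodule.fg_iff_exists_fin_generating_family.mp
      (IsNoetherian.noetherian J)
    exact hdescent r ⟨a, ha.symm⟩
  intro r
  induction r with
  | zero =>
    rintro ⟨a, rfl⟩
    exact (exists_span_range_eq_of_le d.zero_le a).imp fun _ => Eq.symm
  | succ r ih =>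
    rintro ⟨a, rfl⟩
    rcases le_or_gt (r + 1) d with hr | hr
    · exact (exists_span_range_eq_of_le hr a).imp fun _ => Eq.symm
    · obtain ⟨n, f, hf, hmem, hres⟩ := hCM.exists_isHomogeneous_eval_mem hdim hr
        (fun i => hJ (Ideal.subset_span ⟨i, rfl⟩)) hM
      obtain ⟨b, hb⟩ := exists_isReduction_span_range hf hmem hres
      exact ih ⟨b, le_antisymm (hJI.2 (hb.trans hJI.1) hb.1) hb.1⟩

end Reduction

theorem mainTheorem12 {A : Type u} [CommRing A] [IsLocalRing A] [IsNoetherianRing A]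
    (p : ℕ) [Fact p.Prime] [CharP A p] (hCM : IsCohenMacaulayLocal A)
    (d : ℕ) (hd : 1 ≤ d) (hdim : ringKrullDim A = (d : WithBot ℕ∞))
    (I J : Ideal A) (hI : I.radical = IsLocalRing.maximalIdeal A)
    (hJ : IsMinimalReduction J I)
    (hgen : Infinite (IsLocalRing.ResidueField A) ∨
      ∃ x : Fin d → A, J = Ideal.span (Set.range x))
    (hIJ : I ^ 2 ≤ J) :
    Tendsto (multiplicitySeq d I) atTop (𝓝 (idealMultiplicity d I)) ∧
      Tendsto (hilbertKunzSeq p d I) atTop (𝓝 (hilbertKunzMultiplicity p d I)) ∧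
      idealMultiplicity d I / 2 ≤ hilbertKunzMultiplicity p d I := by
  have hJI : J ≤ I := hJ.1.1
  have hIm : I ≤ IsLocalRing.maximalIdeal A := hI ▸ Ideal.le_radical
  obtain ⟨M, hM⟩ := Ideal.exists_pow_le_of_le_radical_of_fg hI.ge (IsNoetherian.noetherian _)
  have hMJ : IsLocalRing.maximalIdeal A ^ (M * 2) ≤ J := by
    rw [pow_mul]
    exact (Ideal.pow_right_mono hM 2).trans hIJ
  obtain ⟨x, rfl⟩ : ∃ x : Fin d → A, J = Ideal.span (Set.range x) :=
    hgen.elim (fun _ => hJ.exists_eq_span_range hCM hdim (hJI.trans hIm) hMJ) id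
  have hx (i : Fin d) : x i ∈ IsLocalRing.maximalIdeal A := hIm (hJI (Ideal.subset_span ⟨i, rfl⟩))
  have he := hCM.tendsto_multiplicitySeq p hdim hx hMJ hJ.1
  obtain ⟨L, hL, hle⟩ :=
    hCM.exists_tendsto_hilbertKunzSeq p (Nat.one_le_iff_ne_zero.mp hd) hdim hx hMJ hJI hIJ
  rw [hilbertKunzMultiplicity, idealMultiplicity, he.limUnder_eq, hL.limUnder_eq]
  exact ⟨he, hL, hle⟩
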